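/- Let $v>0$, $c>0$ be constants with $v/c>\sqrt2$, and let $s\in\mathbb R$. For $\gamma\ge 1$ and $(\delta,\eta)\in\mathbb R^2$ put $\tau=\gamma+i\delta$, $\Lambda=(\gamma^2+\delta^2+\eta^2)^{1/2}$, and let $$\mu^\pm=\sqrt{\Big(\frac{\tau\pm iv\eta}{c}\Big)^2+\eta^2},\qquad \Re\mu^\pm>0 .$$ For a distribution $u$ on $\mathbb R^2$ (variables $(t,x_1)$, dual variables $(\delta,\eta)$) let $\widehat u$ denote the Fourier transform (with kernel $e^{-i(\delta t+\eta x_1)}$) of $e^{-\gamma t}u$. Let $H^s_\gamma(\mathbb R^2)=\{u\in\mathcal D'(\mathbb R^2): e^{-\gamma t}u\in H^s(\mathbb R^2)\}$, with $\|u\|^2_{H^s_\gamma}=(2\pi)^{-2}\iint\Lambda^{2s}|\widehat u|^2\,d\delta\,d\eta$, and let $L^2(\mathbb R^\pm;H^s_\gamma(\mathbb R^2))$ be normed by $\|F\|^2=\int_0^\infty\|F(\cdot,\pm y)\|^2_{H^s_\gamma}\,dy$. There is a constant $C>0$, independent of $\gamma$ and of $\mathcal F^\pm$, such that for every $\gamma\ge1$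 and all $\mathcal F^+\in L^2(\mathbb R^+;H^s_\gamma(\mathbb R^2))$, $\mathcal F^-\in L^2(\mathbb R^-;H^s_\gamma(\mathbb R^2))$, the equation $$\Big(\tau^2+v^2\eta^2\Big(8\Big(\frac{\tau/c}{\mu^++\mu^-}\Big)^2-1\Big)\Big)\widehat f+\frac{\mu^+\mu^-}{\mu^++\mu^-}\,M=0\qquad\text{for a.e. }(\delta,\eta)\in\mathbb R^2,$$ $$M=\frac1{\mu^+}\int_0^\infty e^{-\mu^+y}\,\widehat{\mathcal F}^+(\cdot,y)\,dy-\frac1{\mu^-}\int_0^\infty e^{-\mu^-y}\,\widehat{\mathcal F}^-(\cdot,-y)\,dy,$$ has a unique solution $f\in H^{s+1}_\gamma(\mathbb R^2)$, and this solution satisfies $$\gamma^3\|f\|^2_{H^{s+1}_\gamma(\mathbb R^2)}\le C\Big(\|\mathcal F^+\|^2_{L^2(\mathbb R^+;H^s_\gamma(\mathbb R^2))}+\|\mathcal F^-\|^2_{L^2(\mathbb R^-;H^s_\gamma(\mathbb R^2))}\Big).$$ -/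

import Mathlib

open MeasureTheory Set
open scoped SchwartzMap FourierTransform Distributions ENNReal

noncomputable section

namespace VortexSheet

/-! ### The symbol of the front equation -/

/-- The complex frequency `τ = γ + i δ`. -/
def tau (γ δ : ℝ) : ℂ := (γ : ℂ) + Complex.I * (δ : ℂ)

/-- The radicand `((τ ± i v η) / c)² + η²`; the sign is chosen through `ε = 1` or `ε = -1`. -/
def radicand (v c ε : ℝ) (τ : ℂ) (η : ℝ) : ℂ :=
  ((τ + (ε : ℂ) * Complex.I * (v : ℂ) * (η : ℂ)) / (c : ℂ)) ^ 2 + (η : ℂ) ^ 2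

/-- The principal square root of the radicand. By `root_sq` and `root_re_pos` below it is the
square root of positive real part whenever `Re τ > 0`. -/
def root (v c ε : ℝ) (τ : ℂ) (η : ℝ) : ℂ := (radicand v c ε τ η) ^ (1 / 2 : ℂ)

/-- `μ⁺` -/
def muPlus (v c : ℝ) (τ : ℂ) (η : ℝ) : ℂ := root v c 1 τ η

/-- `μ⁻` -/
def muMinus (v c : ℝ) (τ : ℂ) (η : ℝ) : ℂ := root v c (-1) τ η

theorem root_sq (v c ε : ℝ) (τ : ℂ) (η : ℝ) : root v c ε τ η ^ 2 = radicand v c ε τ η := by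
  unfold root
  rw [← Complex.cpow_nat_mul]
  norm_num

theorem root_re_pos (v c ε : ℝ) (hc : 0 < c) (τ : ℂ) (hτ : 0 < τ.re) (η : ℝ) :
    0 < (root v c ε τ η).re := by
  set z : ℂ := (τ + (ε : ℂ) * Complex.I * (v : ℂ) * (η : ℂ)) / (c : ℂ) with hz
  have hzre : 0 < z.re := by
    have h : z.re = τ.re / c := by
      rw [hz, Complex.div_ofReal_re]
      simp
    rw [h]
    positivity
  have hw : radicand v c ε τ η = z ^ 2 + (η : ℂ) ^ 2 := rfl
  have hre : (z ^ 2 + (η : ℂ) ^ 2).re = z.re ^ 2 - z.im ^ 2 + η ^ 2 := by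
    simp [pow_two]
  have him : (z ^ 2 + (η : ℂ) ^ 2).im = 2 * z.re * z.im := by
    simp [pow_two]; ring
  have hslit : radicand v c ε τ η ∈ Complex.slitPlane := by
    rw [hw, Complex.mem_slitPlane_iff, hre, him]
    by_cases h0 : z.im = 0
    · left
      rw [h0]
      nlinarith [sq_nonneg η, pow_pos hzre 2]
    · right
      exact mul_ne_zero (by positivity) h0
  have hne : radicand v c ε τ η ≠ 0 := Complex.slitPlane_ne_zero hslit
  have harg : (radicand v c ε τ η).arg < Real.pi :=
    lt_of_le_of_ne (Complex.arg_le_pi _) (Complex.mem_slitPlane_iff_arg.mp hslit).1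
  have harg' := Complex.neg_pi_lt_arg (radicand v c ε τ η)
  have hform : root v c ε τ η = Complex.exp (Complex.log (radicand v c ε τ η) * (1 / 2 : ℂ)) := by
    unfold root
    rw [Complex.cpow_def_of_ne_zero hne]
  rw [hform, Complex.exp_re]
  have h2 : (Complex.log (radicand v c ε τ η) * (1 / 2 : ℂ)).im =
      (radicand v c ε τ η).arg / 2 := by
    have : (1 / 2 : ℂ) = ((1 / 2 : ℝ) : ℂ) := by norm_num
    rw [this, Complex.im_mul_ofReal, Complex.log_im]
    ring
  rw [h2]
  exact mul_pos (Real.exp_pos _)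
    (Real.cos_pos_of_mem_Ioo ⟨by linarith, by linarith⟩)

/-- The symbol `Σ(τ, η) = τ² + v² η² (8 ((τ / c) / (μ⁺ + μ⁻))² - 1)`. -/
def symbol (v c : ℝ) (τ : ℂ) (η : ℝ) : ℂ :=
  τ ^ 2 + (v : ℂ) ^ 2 * (η : ℂ) ^ 2 *
    (8 * ((τ / (c : ℂ)) / (muPlus v c τ η + muMinus v c τ η)) ^ 2 - 1)

/-! ### Distributions on the plane and weighted Sobolev spaces -/

/-- The plane. Coordinate `0` is `t` (dually `δ`) and coordinate `1` is `x₁` (dually `η`). -/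
abbrev Plane : Type := EuclideanSpace ℝ (Fin 2)

/-- The space `𝓓'(ℝ²)` of complex distributions on the plane. -/
abbrev PlaneDistribution : Type := 𝓓'((⊤ : TopologicalSpace.Opens Plane), ℂ)

/-- The test function `e^{-γ t} φ(t, x₁)`. -/
def expMul (γ : ℝ) (φ : 𝓓((⊤ : TopologicalSpace.Opens Plane), ℝ)) :
    𝓓((⊤ : TopologicalSpace.Opens Plane), ℝ) where
  toFun x := Real.exp (-γ * x 0) * φ x
  contDiff' := by
    have h : ContDiff ℝ ((⊤ : ℕ∞) : WithTop ℕ∞) (fun x : Plane => Real.exp (-γ * x 0)) := by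
      fun_prop
    exact h.mul φ.contDiff
  hasCompactSupport' := φ.hasCompactSupport.mul_left
  tsupport_subset' := by simp

/-- A test function, seen as a complex Schwartz function. -/
def testToSchwartz (φ : 𝓓((⊤ : TopologicalSpace.Opens Plane), ℝ)) : 𝓢(Plane, ℂ) :=
  HasCompactSupport.toSchwartzMap (f := fun x => ((φ x : ℝ) : ℂ))
    (φ.hasCompactSupport.comp_left (g := fun r : ℝ => (r : ℂ)) Complex.ofReal_zero)
    (Complex.ofRealCLM.contDiff.comp φ.contDiff)

/-- The distribution `e^{-γ t} u` is (the restriction to test functions of) the tempered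
distribution `T`. -/
def IsExpWeighted (γ : ℝ) (u : PlaneDistribution) (T : 𝓢'(Plane, ℂ)) : Prop :=
  ∀ φ : 𝓓((⊤ : TopologicalSpace.Opens Plane), ℝ), u (expMul γ φ) = T (testToSchwartz φ)

/-- `u ∈ H^s_γ(ℝ²)`: the distribution `e^{-γ t} u` belongs to `H^s(ℝ²)`. -/
def MemHs (γ s : ℝ) (u : PlaneDistribution) : Prop :=
  ∃ T : 𝓢'(Plane, ℂ), IsExpWeighted γ u T ∧ TemperedDistribution.MemSobolev s 2 T

/-- The tempered distribution `T` has the function `w` as Fourier transform, for the normalisation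
`w(ξ) = ∫ e^{-i x·ξ} T(x) dx`. Mathlib's kernel is `e^{-2π i x·ξ}`, so that `𝓕 T` is the function
`ξ ↦ w(2π ξ)`. -/
def HasFourierFun (T : 𝓢'(Plane, ℂ)) (w : Plane → ℂ) : Prop :=
  ∀ φ : 𝓢(Plane, ℂ),
    Integrable (fun ξ : Plane => w ((2 * Real.pi) • ξ) * φ ξ) ∧
      𝓕 T φ = ∫ ξ : Plane, w ((2 * Real.pi) • ξ) * φ ξ

/-- The function `w` is `û`, the Fourier transform of `e^{-γ t} u`; it is unique up to null
sets. -/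
def IsHat (γ : ℝ) (u : PlaneDistribution) (w : Plane → ℂ) : Prop :=
  ∃ T : 𝓢'(Plane, ℂ), IsExpWeighted γ u T ∧ HasFourierFun T w

/-- The weight `Λ(τ, η) = (γ² + δ² + η²)^{1/2}` at `ξ = (δ, η)`. -/
def Lam (γ : ℝ) (ξ : Plane) : ℝ := Real.sqrt (γ ^ 2 + ξ 0 ^ 2 + ξ 1 ^ 2)

/-- `‖u‖²_{H^s_γ} = (2π)⁻² ∬ Λ^{2s} |û|² dδ dη`, with value `∞` if `û` is not a function. -/
def normSq (γ s : ℝ) (u : PlaneDistribution) : ℝ≥0∞ :=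
  ⨅ (w : Plane → ℂ) (_ : IsHat γ u w),
    ENNReal.ofReal (1 / (2 * Real.pi) ^ 2) *
      ∫⁻ ξ : Plane, ENNReal.ofReal (Lam γ ξ ^ (2 * s) * ‖w ξ‖ ^ 2)

/-- `F ∈ L²(ℝ⁺; H^s_γ(ℝ²))`: for almost every `y > 0` the distribution `F y` is in `H^s_γ(ℝ²)`, and
`F` is strongly measurable and square integrable on `(0, ∞)`, where `H^s_γ(ℝ²)` is identified with
`L²(ℝ²)` through the isomorphism `u ↦ Λ^s û` (isometric up to the factor `2π`). -/
def MemL2Hs (γ s : ℝ) (F : ℝ → PlaneDistribution) : Prop :=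
  (∀ᵐ y ∂(volume.restrict (Ioi (0 : ℝ))), MemHs γ s (F y)) ∧
  ∃ Φ : ℝ → Lp ℂ 2 (volume : Measure Plane),
    MemLp Φ 2 (volume.restrict (Ioi (0 : ℝ))) ∧
    ∀ᵐ y ∂(volume.restrict (Ioi (0 : ℝ))),
      IsHat γ (F y) (fun ξ => ((Lam γ ξ ^ (-s) : ℝ) : ℂ) * Φ y ξ)

/-- `‖F‖²_{L²(ℝ⁺; H^s_γ)} = ∫₀^∞ ‖F(·, y)‖²_{H^s_γ} dy`. -/
def l2NormSq (γ s : ℝ) (F : ℝ → PlaneDistribution) : ℝ≥0∞ :=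
  ∫⁻ y in Ioi (0 : ℝ), normSq γ s (F y)

/-- Reflection `y ↦ F(·, -y)`, which carries families on `ℝ⁻` to families on `ℝ⁺`. -/
def reflect (F : ℝ → PlaneDistribution) : ℝ → PlaneDistribution := fun y => F (-y)

/-! ### The front equation -/

/-- `G(ξ, y)` is a jointly measurable version, on `ℝ² × ℝ⁺`, of the partial Fourier transform
`F̂(ξ, y)`. -/
def IsPartialHat (γ : ℝ) (F : ℝ → PlaneDistribution) (G : Plane × ℝ → ℂ) : Prop :=
  AEStronglyMeasurable G
    ((volume : Measure Plane).prod (volume.restrict (Ioi (0 : ℝ)))) ∧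
  ∀ᵐ y ∂(volume.restrict (Ioi (0 : ℝ))), IsHat γ (F y) (fun ξ => G (ξ, y))

/-- `M = (1/μ⁺) ∫₀^∞ e^{-μ⁺ y} F̂⁺(·, y) dy - (1/μ⁻) ∫₀^∞ e^{-μ⁻ y} F̂⁻(·, -y) dy`, where `Gp` and
`Gm` stand for `F̂⁺(·, y)` and `F̂⁻(·, -y)`, `y > 0`. -/
def sourceM (v c γ : ℝ) (Gp Gm : Plane × ℝ → ℂ) (ξ : Plane) : ℂ :=
  (1 / muPlus v c (tau γ (ξ 0)) (ξ 1)) *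
      (∫ y in Ioi (0 : ℝ), Complex.exp (-muPlus v c (tau γ (ξ 0)) (ξ 1) * (y : ℂ)) * Gp (ξ, y)) -
    (1 / muMinus v c (tau γ (ξ 0)) (ξ 1)) *
      (∫ y in Ioi (0 : ℝ), Complex.exp (-muMinus v c (tau γ (ξ 0)) (ξ 1) * (y : ℂ)) * Gm (ξ, y))

/-- `f` solves `Σ f̂ + (μ⁺ μ⁻ / (μ⁺ + μ⁻)) M = 0` for almost every frequency `(δ, η)`, where
`τ = γ + i δ`. The integrals in `M` are required to converge absolutely for almost every
frequency. -/
def SolvesFrontEq (v c γ : ℝ) (Fp Fm : ℝ → PlaneDistribution) (f : PlaneDistribution) : Prop :=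
  ∃ (fhat : Plane → ℂ) (Gp Gm : Plane × ℝ → ℂ),
    IsHat γ f fhat ∧ IsPartialHat γ Fp Gp ∧ IsPartialHat γ (reflect Fm) Gm ∧
    ∀ᵐ ξ : Plane,
      IntegrableOn (fun y : ℝ =>
        Complex.exp (-muPlus v c (tau γ (ξ 0)) (ξ 1) * (y : ℂ)) * Gp (ξ, y)) (Ioi 0) ∧
      IntegrableOn (fun y : ℝ =>
        Complex.exp (-muMinus v c (tau γ (ξ 0)) (ξ 1) * (y : ℂ)) * Gm (ξ, y)) (Ioi 0) ∧
      symbol v c (tau γ (ξ 0)) (ξ 1) * fhat ξ +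
        (muPlus v c (tau γ (ξ 0)) (ξ 1) * muMinus v c (tau γ (ξ 0)) (ξ 1)) /
          (muPlus v c (tau γ (ξ 0)) (ξ 1) + muMinus v c (tau γ (ξ 0)) (ξ 1)) *
          sourceM v c γ Gp Gm ξ = 0

end VortexSheet

end

noncomputable section

namespace VortexSheet

/-! ### The lower bound for the symbol -/

/-! At almost every frequency the equation is division by the symbol `Σ`, so everything rests on a
lower bound for `Σ`. Put `T = τ/c`, `m = v/c`, `p = μ⁺`, `q = μ⁻`. The relations `p² - q² = 4imTη`
and `p² + q² = 2(T² - m²η²) + 2η²` turn the symbol into `Σ = c²(pq - η²)` (`RootPair.symbol_eq`).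
The solution has transform `-(qI - pJ) / (Σ(p + q))`, where `I`, `J` are the two Laplace integrals,
so the bound needed is `|Σ| |p + q| ≥ k γ Λ max(|p|, |q|)` (`exists_symbol_bound`).

It is proved in three regimes. If `|Im T| ≥ |mη|`, the roots lie in the same quadrant: nothing
cancels in `p + q`, and `Im(pq)` alone is large because `m² > 2`. If `|Im T| ≤ |mη|` and `Re T`
dominates `η`, then `|p|, |q| ≥ Re T` suffices. In the remaining regime `|η|` is comparable to the
full frequency. Multiplying by the conjugate factors `pq + η²` and `p - q` gives the explicit
polynomial `4imηT(T² + A²η²)(T² + B²η²)`. The hypothesis `m² > 2` makes `A` real and nonzero, and `B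
> |m|` keeps the last factor away from zero. The other zeros `0, ±iAη` are simple and separated, so
the product is small only like one power of `Re T`, which costs a single factor `γ`.

Cauchy–Schwarz with `Re p, Re q ≥ γ/c` gives `|I|² ≤ (c/2γ) ∫ |F̂⁺|²`, and likewise for `J`;
integrating against `Λ^{2s}` produces `γ³` and `C = c/k²`. The rest is functional analysis: `û` is
unique almost everywhere (test functions are dense in the Schwartz space), every measurable function
of finite weighted norm is some `û` (`exists_memHs_isHat`), and an `L²`-valued family has a jointly
measurable version (`exists_isVersion`), which gives meaning to `I` and `J`. -/

/-- The real part of a square root of `z² + η²` dominates the real part of `z`. -/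
theorem le_re_of_sq_eq {p z : ℂ} {η : ℝ} (hp : 0 < p.re) (hz : 0 < z.re)
    (h : p ^ 2 = z ^ 2 + (η : ℂ) ^ 2) : z.re ≤ p.re := by
  have h1 := congrArg Complex.re h
  have h2 := congrArg Complex.im h
  simp [pow_two] at h1 h2
  have h3 : p.re * p.im = z.re * z.im := by linarith
  -- Eliminating `p.im` between the real and imaginary parts leaves an identity whose right side is
  -- visibly nonnegative.
  have h4 : (p.re ^ 2 - z.re ^ 2) * (p.re ^ 2 + z.im ^ 2) = p.re ^ 2 * η ^ 2 := by
    have : p.re ^ 2 * p.im ^ 2 = z.re ^ 2 * z.im ^ 2 := by rw [← mul_pow, h3, mul_pow]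
    linear_combination p.re ^ 2 * h1 + this
  have h5 : 0 ≤ p.re ^ 2 - z.re ^ 2 := by
    by_contra! h6
    have h7 : 0 < p.re ^ 2 + z.im ^ 2 := by positivity
    have : 0 ≤ p.re ^ 2 * η ^ 2 := by positivity
    nlinarith
  nlinarith

/-- The data of a frequency `(T, η)` in normalised form, with the two roots `p` and `q`. -/
structure RootPair (m : ℝ) (T : ℂ) (η : ℝ) (p q : ℂ) : Prop where
  re_pos : 0 < T.re
  p_re : 0 < p.re
  q_re : 0 < q.re
  p_sq : p ^ 2 = (T + Complex.I * m * η) ^ 2 + (η : ℂ) ^ 2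
  q_sq : q ^ 2 = (T - Complex.I * m * η) ^ 2 + (η : ℂ) ^ 2

namespace RootPair

variable {m : ℝ} {T : ℂ} {η : ℝ} {p q : ℂ}

theorem symm (h : RootPair m T η p q) : RootPair (-m) T η q p where
  re_pos := h.re_pos
  p_re := h.q_re
  q_re := h.p_re
  p_sq := by rw [h.q_sq]; push_cast; ring
  q_sq := by rw [h.p_sq]; push_cast; ring

theorem re_le_p (h : RootPair m T η p q) : T.re ≤ p.re := by
  have := le_re_of_sq_eq h.p_re (z := T + Complex.I * m * η) (by simpa using h.re_pos) h.p_sq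
  simpa using this

theorem re_le_q (h : RootPair m T η p q) : T.re ≤ q.re := h.symm.re_le_p

theorem p_im (h : RootPair m T η p q) : p.re * p.im = T.re * (T.im + m * η) := by
  have h2 := congrArg Complex.im h.p_sq
  simp [pow_two] at h2
  linarith

theorem q_im (h : RootPair m T η p q) : q.re * q.im = T.re * (T.im - m * η) := by
  rw [h.symm.p_im]; ring

theorem p_re_sq (h : RootPair m T η p q) :
    p.re ^ 2 - p.im ^ 2 = T.re ^ 2 - (T.im + m * η) ^ 2 + η ^ 2 := by
  have h2 := congrArg Complex.re h.p_sq
  simp [pow_two] at h2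
  linarith

theorem q_re_sq (h : RootPair m T η p q) :
    q.re ^ 2 - q.im ^ 2 = T.re ^ 2 - (T.im - m * η) ^ 2 + η ^ 2 := by
  rw [h.symm.p_re_sq]; ring

theorem add_ne_zero (h : RootPair m T η p q) : p + q ≠ 0 := by
  intro h0
  have := congrArg Complex.re h0
  simp at this
  linarith [h.p_re, h.q_re]

theorem sq_sub_sq (h : RootPair m T η p q) : p ^ 2 - q ^ 2 = 4 * Complex.I * m * T * η := by
  rw [h.p_sq, h.q_sq]; ring

/-- The symbol is `c² (μ⁺ μ⁻ - η²)`. -/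
theorem symbol_eq (h : RootPair m T η p q) :
    T ^ 2 + (m : ℂ) ^ 2 * (η : ℂ) ^ 2 * (8 * (T / (p + q)) ^ 2 - 1) = p * q - (η : ℂ) ^ 2 := by
  have h0 := h.add_ne_zero
  have hS : p ^ 2 + q ^ 2 = 2 * (T ^ 2 - m ^ 2 * η ^ 2) + 2 * η ^ 2 := by
    rw [h.p_sq, h.q_sq]
    linear_combination (2 * (m : ℂ) ^ 2 * η ^ 2) * Complex.I_sq
  have hD := h.sq_sub_sq
  field_simp
  linear_combination (-(p + q) ^ 2 / 2) * hS +
    (1 / 2) * (p ^ 2 - q ^ 2 + 4 * Complex.I * m * T * η) * hD +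
    (8 * (m : ℂ) ^ 2 * T ^ 2 * η ^ 2) * Complex.I_sq

/-- Rationalising removes the square roots: `p²q² - η⁴` is a polynomial in `T²` and `η²`, and
`-aη²`, `-bη²` are its roots in `T²`. -/
theorem sub_mul_add (h : RootPair m T η p q) {a b : ℂ} (hab : a + b = 2 * (1 + (m : ℂ) ^ 2))
    (hab' : a * b = (m : ℂ) ^ 4 - 2 * (m : ℂ) ^ 2) :
    (p * q - (η : ℂ) ^ 2) * (p * q + (η : ℂ) ^ 2) =
      (T ^ 2 + a * η ^ 2) * (T ^ 2 + b * η ^ 2) := by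
  have e : (p * q - (η : ℂ) ^ 2) * (p * q + (η : ℂ) ^ 2) = p ^ 2 * q ^ 2 - (η : ℂ) ^ 4 := by ring
  have hI4 : Complex.I ^ 4 = 1 := Complex.I_pow_four
  rw [e, h.p_sq, h.q_sq]
  linear_combination (-(T : ℂ) ^ 2 * η ^ 2) * hab - (η : ℂ) ^ 4 * hab' +
    ((-2 * T ^ 2 * m ^ 2 * η ^ 2 + 2 * m ^ 2 * η ^ 4)) * Complex.I_sq +
    ((m : ℂ) ^ 4 * η ^ 4) * hI4

theorem normSq_p_le (h : RootPair m T η p q) :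
    ‖p‖ ^ 2 ≤ (3 + 2 * m ^ 2) * (‖T‖ ^ 2 + η ^ 2) := by
  have h1 : ‖p‖ ^ 2 ≤ ‖T + Complex.I * m * η‖ ^ 2 + η ^ 2 := by
    rw [← norm_pow, h.p_sq]
    refine (norm_add_le _ _).trans ?_
    simp
  have h2 : ‖T + Complex.I * m * η‖ ≤ ‖T‖ + |m| * |η| := by
    refine (norm_add_le _ _).trans ?_
    simp
  have h3 : ‖T + Complex.I * m * η‖ ^ 2 ≤ (‖T‖ + |m| * |η|) ^ 2 := by gcongr
  have h4 : (|m| * |η|) ^ 2 = m ^ 2 * η ^ 2 := by rw [mul_pow, sq_abs, sq_abs]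
  nlinarith [sq_nonneg (‖T‖ - |m| * |η|), sq_nonneg ‖T‖, sq_nonneg η, sq_nonneg m,
    mul_nonneg (sq_nonneg m) (sq_nonneg ‖T‖)]

/-- The two roots lie in the same quadrant when `m |η| ≤ |Im T|`. -/
theorem im_mul_im_nonneg (h : RootPair m T η p q) (hs : m ^ 2 * η ^ 2 ≤ T.im ^ 2) :
    0 ≤ p.im * q.im := by
  have h3 : (p.re * p.im) * (q.re * q.im) = T.re ^ 2 * (T.im ^ 2 - m ^ 2 * η ^ 2) := by
    rw [h.p_im, h.q_im]; ring
  have h4 : 0 ≤ (p.re * q.re) * (p.im * q.im) := by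
    have : 0 ≤ T.re ^ 2 * (T.im ^ 2 - m ^ 2 * η ^ 2) :=
      mul_nonneg (sq_nonneg _) (by linarith)
    nlinarith
  exact nonneg_of_mul_nonneg_right h4 (mul_pos h.p_re h.q_re)

/-- Only the imaginary part of `pq - η²` is used. Its two terms have the same sign, so its square
dominates the sum of their squares. -/
theorem sq_re_mul_le_normSq (h : RootPair m T η p q) (hm : 2 < m ^ 2)
    (hs : m ^ 2 * η ^ 2 ≤ T.im ^ 2) :
    2 * T.re ^ 2 * (η ^ 2 + T.im ^ 2) ≤ ‖p * q - (η : ℂ) ^ 2‖ ^ 2 := by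
  have hp := h.re_le_p
  have hq := h.re_le_q
  have hT := h.re_pos
  have h1 := h.p_re_sq
  have h2 := h.q_re_sq
  have hpq := h.im_mul_im_nonneg hs
  have him : (p * q - (η : ℂ) ^ 2).im = p.re * q.im + p.im * q.re := by
    simp [pow_two]
  have h5 : (p * q - (η : ℂ) ^ 2).im ^ 2 ≤ ‖p * q - (η : ℂ) ^ 2‖ ^ 2 := by
    rw [← sq_abs]
    gcongr
    exact Complex.abs_im_le_norm _
  refine le_trans ?_ h5
  rw [him]
  have h6 : T.re ^ 2 ≤ p.re ^ 2 := by gcongr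
  have h7 : T.re ^ 2 ≤ q.re ^ 2 := by gcongr
  have h8 : 0 ≤ (p.re * q.re) * (p.im * q.im) :=
    mul_nonneg (mul_nonneg h.p_re.le h.q_re.le) hpq
  -- Adding the real parts of `p²` and `q²` gives `p.im² + q.im² ≥ 2 T.im² + 2(m² - 1)η²`, and `m² >
  -- 2` makes the last coefficient at least `2`.
  have h9 : 2 * (η ^ 2 + T.im ^ 2) ≤ p.im ^ 2 + q.im ^ 2 := by
    nlinarith [mul_nonneg (sub_nonneg.2 hm.le) (sq_nonneg η)]
  calc 2 * T.re ^ 2 * (η ^ 2 + T.im ^ 2) = T.re ^ 2 * (2 * (η ^ 2 + T.im ^ 2)) := by ring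
    _ ≤ T.re ^ 2 * (p.im ^ 2 + q.im ^ 2) := by gcongr
    _ = T.re ^ 2 * q.im ^ 2 + T.re ^ 2 * p.im ^ 2 := by ring
    _ ≤ p.re ^ 2 * q.im ^ 2 + q.re ^ 2 * p.im ^ 2 := by gcongr
    _ ≤ (p.re * q.im + p.im * q.re) ^ 2 := by linarith

theorem norm_p_le_norm_add (h : RootPair m T η p q) (hs : m ^ 2 * η ^ 2 ≤ T.im ^ 2) :
    ‖p‖ ≤ ‖p + q‖ := by
  have hpq := h.im_mul_im_nonneg hs
  have : ‖p‖ ^ 2 ≤ ‖p + q‖ ^ 2 := by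
    rw [← Complex.normSq_eq_norm_sq, ← Complex.normSq_eq_norm_sq, Complex.normSq_apply,
      Complex.normSq_apply, Complex.add_re, Complex.add_im]
    nlinarith [mul_pos h.p_re h.q_re, sq_nonneg q.re, sq_nonneg q.im]
  exact le_of_sq_le_sq this (norm_nonneg _)

theorem re_sq_sub_le_norm (h : RootPair m T η p q) :
    T.re ^ 2 - η ^ 2 ≤ ‖p * q - (η : ℂ) ^ 2‖ := by
  have h1 : ‖p * q‖ - ‖(η : ℂ) ^ 2‖ ≤ ‖p * q - (η : ℂ) ^ 2‖ := norm_sub_norm_le _ _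
  have h2 : ‖(η : ℂ) ^ 2‖ = η ^ 2 := by simp
  have h3 : T.re * T.re ≤ ‖p‖ * ‖q‖ :=
    mul_le_mul (h.re_le_p.trans (Complex.re_le_norm p)) (h.re_le_q.trans (Complex.re_le_norm q))
      h.re_pos.le (norm_nonneg _)
  rw [norm_mul, h2] at h1
  nlinarith

/-- The bound where both roots lie in the same quadrant. -/
theorem bound_of_le (h : RootPair m T η p q) (hm : 2 < m ^ 2)
    (hs : m ^ 2 * η ^ 2 ≤ T.im ^ 2) :
    (1 / 3) * T.re * √(‖T‖ ^ 2 + η ^ 2) ≤ ‖p * q - (η : ℂ) ^ 2‖ := by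
  have h1 := h.sq_re_mul_le_normSq hm hs
  have h2 := h.re_sq_sub_le_norm
  have hT := h.re_pos
  have hn : ‖T‖ ^ 2 = T.re ^ 2 + T.im ^ 2 := by
    rw [← Complex.normSq_eq_norm_sq, Complex.normSq_apply]; ring
  refine le_of_sq_le_sq ?_ (norm_nonneg _)
  rw [mul_pow, Real.sq_sqrt (by positivity), hn]
  set X := ‖p * q - (η : ℂ) ^ 2‖
  have hX : 0 ≤ X := norm_nonneg _
  have h0 : 0 < T.re ^ 2 := by positivity
  -- The bound from the imaginary part lacks a `T.re ^ 4` term; either `η` absorbs it, or the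
  -- modulus bound `T.re ^ 2 / 2 ≤ X` supplies it.
  by_cases h3 : T.re ^ 2 ≤ 2 * η ^ 2
  · nlinarith [mul_le_mul_of_nonneg_left h3 h0.le, mul_nonneg h0.le (sq_nonneg T.im),
      mul_nonneg h0.le (sq_nonneg η)]
  · push Not at h3
    have h4 : T.re ^ 2 / 2 ≤ X := by linarith
    have h5 : (T.re ^ 2 / 2) ^ 2 ≤ X ^ 2 := by gcongr
    nlinarith [mul_nonneg h0.le (sq_nonneg T.im), mul_nonneg h0.le (sq_nonneg η)]

theorem norm_add_I_mul_le {z : ℂ} {b : ℝ} : |z.im + b| ≤ ‖z + Complex.I * b‖ := by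
  have := Complex.abs_im_le_norm (z + Complex.I * b)
  simpa using this

/-- Three points `0`, `± i b` of the imaginary axis are not simultaneously close to `z`. -/
theorem re_mul_sq_le {z : ℂ} (hz : 0 < z.re) (b : ℝ) :
    z.re * (b / 2) ^ 2 ≤ ‖z ^ 2 + (b : ℂ) ^ 2‖ * ‖z‖ := by
  have e : z ^ 2 + (b : ℂ) ^ 2 = (z + Complex.I * b) * (z + Complex.I * (-b : ℝ)) := by
    push_cast
    linear_combination (b : ℂ) ^ 2 * Complex.I_sq
  rw [e, norm_mul]
  have r1 : z.re ≤ ‖z + Complex.I * b‖ := by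
    simpa using Complex.re_le_norm (z + Complex.I * b)
  have r2 : z.re ≤ ‖z + Complex.I * (-b : ℝ)‖ := by
    simpa using Complex.re_le_norm (z + Complex.I * (-b : ℝ))
  have r3 : z.re ≤ ‖z‖ := Complex.re_le_norm z
  have i1 := @norm_add_I_mul_le z b
  have i2 := @norm_add_I_mul_le z (-b)
  have i3 := Complex.abs_im_le_norm z
  set x := ‖z + Complex.I * b‖
  set y := ‖z + Complex.I * (-b : ℝ)‖
  set w := ‖z‖
  have hb : (b / 2) ^ 2 = |b| / 2 * (|b| / 2) := by rw [← sq_abs, abs_div]; norm_num; ring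
  rw [hb]
  have key : ∀ {x y w : ℝ}, z.re ≤ x → |b| / 2 ≤ y → |b| / 2 ≤ w →
      z.re * (|b| / 2 * (|b| / 2)) ≤ x * (y * w) := by
    intro x y w hx hy hw
    have h0 : 0 ≤ |b| / 2 := by positivity
    exact mul_le_mul hx (mul_le_mul hy hw h0 (h0.trans hy)) (mul_nonneg h0 h0) (hz.le.trans hx)
  -- The points `0, ±ib` are at mutual distance at least `|b|`, so at most one is closer than
  -- `|b|/2` to `z`. The other two distances give `(b/2)²`, and the exceptional one is still at
  -- least `z.re`.
  by_cases hx : |b| / 2 ≤ x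
  · by_cases hy : |b| / 2 ≤ y
    · linarith [key r3 hx hy]
    · have hw : |b| / 2 ≤ w := by
        rcases abs_cases b with hb | hb <;> rcases abs_cases (z.im + -b) with h2 | h2 <;>
          rcases abs_cases z.im with h3 | h3 <;> linarith
      linarith [key r2 hx hw]
  · have hw : |b| / 2 ≤ w := by
      rcases abs_cases b with hb | hb <;> rcases abs_cases (z.im + b) with h2 | h2 <;>
        rcases abs_cases z.im with h3 | h3 <;> linarith
    have hy : |b| / 2 ≤ y := by
      rcases abs_cases b with hb | hb <;> rcases abs_cases (z.im + b) with h2 | h2 <;>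
        rcases abs_cases (z.im + -b) with h3 | h3 <;> linarith
    linarith [key r1 hy hw]

/-- The zeros `±ib` lie outside the strip containing `z`, at vertical distance at least `b - e`; no
positivity of the real part is needed. -/
theorem sq_le_norm_sq_add_sq {z : ℂ} {b e : ℝ} (hb : |z.im| ≤ e) (hbe : e ≤ b) :
    (b - e) ^ 2 ≤ ‖z ^ 2 + (b : ℂ) ^ 2‖ := by
  have e : z ^ 2 + (b : ℂ) ^ 2 = (z + Complex.I * b) * (z + Complex.I * (-b : ℝ)) := by
    push_cast
    linear_combination (b : ℂ) ^ 2 * Complex.I_sq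
  rw [e, norm_mul, pow_two]
  have i1 := @norm_add_I_mul_le z b
  have i2 := @norm_add_I_mul_le z (-b)
  have := abs_le.1 hb
  apply mul_le_mul
  · linarith [le_abs_self (z.im + b)]
  · linarith [neg_abs_le (z.im + -b)]
  · linarith
  · positivity

theorem norm_p_le (h : RootPair m T η p q) :
    ‖p‖ ≤ √(3 + 2 * m ^ 2) * √(‖T‖ ^ 2 + η ^ 2) := by
  rw [← Real.sqrt_mul (by positivity)]
  exact Real.le_sqrt_of_sq_le h.normSq_p_le

theorem norm_q_le (h : RootPair m T η p q) :
    ‖q‖ ≤ √(3 + 2 * m ^ 2) * √(‖T‖ ^ 2 + η ^ 2) := by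
  simpa using h.symm.norm_p_le

/-- The bound where the real part dominates the tangential frequency. -/
theorem bound_of_two_mul_sq_le (h : RootPair m T η p q)
    (hs : T.im ^ 2 ≤ m ^ 2 * η ^ 2) (hη : 2 * η ^ 2 ≤ T.re ^ 2) :
    T.re * √(‖T‖ ^ 2 + η ^ 2) * ‖p‖ ≤
      √(3 + 2 * m ^ 2) ^ 3 * (‖p * q - (η : ℂ) ^ 2‖ * ‖p + q‖) := by
  have hT := h.re_pos
  have h1 := h.re_sq_sub_le_norm
  have h2 : 2 * T.re ≤ ‖p + q‖ := by
    have := Complex.re_le_norm (p + q)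
    rw [Complex.add_re] at this
    linarith [h.re_le_p, h.re_le_q]
  have hn : ‖T‖ ^ 2 = T.re ^ 2 + T.im ^ 2 := by
    rw [← Complex.normSq_eq_norm_sq, Complex.normSq_apply]; ring
  have h3 := h.norm_p_le
  set K := √(3 + 2 * m ^ 2) with hK
  set N := √(‖T‖ ^ 2 + η ^ 2) with hN
  have hK2 : K ^ 2 = 3 + 2 * m ^ 2 := Real.sq_sqrt (by positivity)
  have hN2 : N ^ 2 = ‖T‖ ^ 2 + η ^ 2 := Real.sq_sqrt (by positivity)
  have hK0 : 0 ≤ K := Real.sqrt_nonneg _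
  have hN0 : 0 ≤ N := Real.sqrt_nonneg _
  have h4 : N ^ 2 ≤ K ^ 2 * T.re ^ 2 := by
    rw [hN2, hK2, hn]
    nlinarith [mul_nonneg (sq_nonneg m) (sub_nonneg.2 hη)]
  have h5 : T.re ^ 2 * T.re ≤ ‖p * q - (η : ℂ) ^ 2‖ * ‖p + q‖ := by
    have : T.re ^ 2 / 2 * (2 * T.re) ≤ ‖p * q - (η : ℂ) ^ 2‖ * ‖p + q‖ :=
      mul_le_mul (by linarith) h2 (by positivity) (norm_nonneg _)
    linarith
  calc T.re * N * ‖p‖ ≤ T.re * N * (K * N) := by gcongr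
    _ = T.re * K * N ^ 2 := by ring
    _ ≤ T.re * K * (K ^ 2 * T.re ^ 2) := by gcongr
    _ = K ^ 3 * (T.re ^ 2 * T.re) := by ring
    _ ≤ _ := by gcongr

/-- The bound where the tangential frequency dominates. -/
theorem bound_of_sq_le_two_mul (h : RootPair m T η p q) {A B : ℝ}
    (hAB : A ^ 2 + B ^ 2 = 2 * (1 + m ^ 2)) (hAB' : A ^ 2 * B ^ 2 = m ^ 4 - 2 * m ^ 2)
    (hB : |m| ≤ B)
    (hs : T.im ^ 2 ≤ m ^ 2 * η ^ 2) (hη : T.re ^ 2 ≤ 2 * η ^ 2) :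
    |m| * A ^ 2 * (B - |m|) ^ 2 * (T.re * √(‖T‖ ^ 2 + η ^ 2) * ‖p‖) ≤
      4 * √(3 + 2 * m ^ 2) ^ 9 * (‖p * q - (η : ℂ) ^ 2‖ * ‖p + q‖) := by
  have hT := h.re_pos
  have hn : ‖T‖ ^ 2 = T.re ^ 2 + T.im ^ 2 := by
    rw [← Complex.normSq_eq_norm_sq, Complex.normSq_apply]; ring
  have h3 := h.norm_p_le
  have h3' := h.norm_q_le
  have hprod := congrArg norm (h.sub_mul_add (a := ((A ^ 2 : ℝ) : ℂ)) (b := ((B ^ 2 : ℝ) : ℂ))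
    (by exact_mod_cast hAB) (by exact_mod_cast hAB'))
  have hfa : (T ^ 2 + ((A ^ 2 : ℝ) : ℂ) * η ^ 2) = T ^ 2 + ((A * η : ℝ) : ℂ) ^ 2 := by
    push_cast; ring
  have hfb : (T ^ 2 + ((B ^ 2 : ℝ) : ℂ) * η ^ 2) = T ^ 2 + ((B * |η| : ℝ) : ℂ) ^ 2 := by
    norm_cast
    rw [mul_pow, sq_abs]
  have hA1 := re_mul_sq_le hT (A * η)
  have him : |T.im| ≤ |m| * |η| := by
    rw [← abs_mul]
    exact sq_le_sq.1 (by rw [mul_pow]; exact hs)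
  have hB1 : (B * |η| - |m| * |η|) ^ 2 ≤ _ :=
    sq_le_norm_sq_add_sq him (mul_le_mul_of_nonneg_right hB (abs_nonneg η))
  rw [norm_mul, norm_mul, hfa, hfb] at hprod
  have hdiff : ‖p + q‖ * ‖p - q‖ = 4 * |m| * ‖T‖ * |η| := by
    rw [← norm_mul, show (p + q) * (p - q) = p ^ 2 - q ^ 2 by ring, h.sq_sub_sq]
    simp
  set K := √(3 + 2 * m ^ 2) with hK
  set N := √(‖T‖ ^ 2 + η ^ 2) with hN
  have hK2 : K ^ 2 = 3 + 2 * m ^ 2 := Real.sq_sqrt (by positivity)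
  have hN2 : N ^ 2 = ‖T‖ ^ 2 + η ^ 2 := Real.sq_sqrt (by positivity)
  have hK0 : 0 ≤ K := Real.sqrt_nonneg _
  have hN0 : 0 < N := by
    have : T ≠ 0 := fun h0 => by simp [h0] at hT
    rw [hN]; positivity
  -- In this regime both parts of `T` are controlled by `η`, so powers of `N` and `|η|` are
  -- interchangeable.
  have hNη : N ≤ K * |η| := by
    refine le_of_sq_le_sq ?_ (by positivity)
    rw [mul_pow, sq_abs, hN2, hK2, hn]
    nlinarith [mul_nonneg (sq_nonneg m) (sq_nonneg η)]
  have hsum : ‖p - q‖ ≤ 2 * K * N := by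
    refine (norm_sub_le _ _).trans ?_
    linarith
  have hplus : ‖p * q + (η : ℂ) ^ 2‖ ≤ 2 * K ^ 2 * N ^ 2 := by
    refine (norm_add_le _ _).trans ?_
    have e1 : ‖p * q‖ ≤ (K * N) * (K * N) := by
      rw [norm_mul]
      exact mul_le_mul h3 h3' (norm_nonneg _) (by positivity)
    have e2 : ‖(η : ℂ) ^ 2‖ ≤ K ^ 2 * N ^ 2 := by
      simp only [norm_pow, Complex.norm_real, Real.norm_eq_abs, sq_abs]
      rw [hK2, hN2]
      nlinarith [sq_nonneg ‖T‖, sq_nonneg η, sq_nonneg m,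
        mul_nonneg (sq_nonneg m) (sq_nonneg ‖T‖), mul_nonneg (sq_nonneg m) (sq_nonneg η)]
    nlinarith
  set X := ‖p * q - (η : ℂ) ^ 2‖
  set a := ‖T ^ 2 + ((A * η : ℝ) : ℂ) ^ 2‖
  set b := ‖T ^ 2 + ((B * |η| : ℝ) : ℂ) ^ 2‖
  set Y := ‖p * q + (η : ℂ) ^ 2‖
  have hX : 0 ≤ X := norm_nonneg _
  -- The factor `‖T‖` from `(p + q)(p - q)` is the third distance in `re_mul_sq_le`; the conjugate
  -- factors are bounded above by powers of `N`.
  have hmain : T.re * (|m| * A ^ 2 * (B - |m|) ^ 2) * |η| ^ 5 ≤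
      (X * ‖p + q‖) * (4 * K ^ 3 * N ^ 3) := by
    calc T.re * (|m| * A ^ 2 * (B - |m|) ^ 2) * |η| ^ 5
        = (T.re * (A * η / 2) ^ 2) * (B * |η| - |m| * |η|) ^ 2 * (4 * |m| * |η|) := by
          have : (A * η / 2) ^ 2 = A ^ 2 * |η| ^ 2 / 4 := by rw [sq_abs]; ring
          rw [this]; ring
      _ ≤ (a * ‖T‖) * b * (4 * |m| * |η|) := by gcongr
      _ = (a * b) * (4 * |m| * ‖T‖ * |η|) := by ring
      _ = (X * Y) * (‖p + q‖ * ‖p - q‖) := by rw [hprod, hdiff]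
      _ ≤ (X * (2 * K ^ 2 * N ^ 2)) * (‖p + q‖ * (2 * K * N)) := by gcongr
      _ = _ := by ring
  set D := |m| * A ^ 2 * (B - |m|) ^ 2 with hD
  have hD0 : 0 ≤ D := by positivity
  -- Both sides are multiplied by `N ^ 3`, to be cancelled at the end; five powers of `N` become
  -- powers of `K * |η|`, hence `K ^ 9`.
  have h5 : (D * (T.re * N * ‖p‖)) * N ^ 3 ≤ (4 * K ^ 9 * (X * ‖p + q‖)) * N ^ 3 := by
    calc (D * (T.re * N * ‖p‖)) * N ^ 3 ≤ (D * (T.re * N * (K * N))) * N ^ 3 := by gcongr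
      _ = K * (T.re * D) * N ^ 5 := by ring
      _ ≤ K * (T.re * D) * (K * |η|) ^ 5 := by gcongr
      _ = K ^ 6 * (T.re * D * |η| ^ 5) := by ring
      _ ≤ K ^ 6 * ((X * ‖p + q‖) * (4 * K ^ 3 * N ^ 3)) := by gcongr
      _ = _ := by ring
  exact le_of_mul_le_mul_right h5 (by positivity)

theorem exists_bound_p {m : ℝ} (hm : 2 < m ^ 2) :
    ∃ k : ℝ, 0 < k ∧ ∀ {T : ℂ} {η : ℝ} {p q : ℂ}, RootPair m T η p q →
      k * (T.re * √(‖T‖ ^ 2 + η ^ 2) * ‖p‖) ≤ ‖p * q - (η : ℂ) ^ 2‖ * ‖p + q‖ := by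
  -- `A²` and `B²` are the roots `1 + m² ∓ r` of `X² - 2(1 + m²)X + m⁴ - 2m²`; the smaller is
  -- positive because `m² > 2`.
  set r := √(1 + 4 * m ^ 2) with hr
  have hr2 : r ^ 2 = 1 + 4 * m ^ 2 := Real.sq_sqrt (by positivity)
  have hr0 : 0 ≤ r := Real.sqrt_nonneg _
  have hr1 : r < 1 + m ^ 2 := by
    refine lt_of_pow_lt_pow_left₀ 2 (by positivity) ?_
    rw [hr2]; nlinarith
  have hr3 : 1 ≤ r := by
    refine le_of_sq_le_sq ?_ hr0
    rw [hr2]; nlinarith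
  set A := √(1 + m ^ 2 - r) with hA
  set B := √(1 + m ^ 2 + r) with hB
  have hA2 : A ^ 2 = 1 + m ^ 2 - r := Real.sq_sqrt (by linarith)
  have hB2 : B ^ 2 = 1 + m ^ 2 + r := Real.sq_sqrt (by positivity)
  have hAB : A ^ 2 + B ^ 2 = 2 * (1 + m ^ 2) := by rw [hA2, hB2]; ring
  have hAB' : A ^ 2 * B ^ 2 = m ^ 4 - 2 * m ^ 2 := by rw [hA2, hB2]; linear_combination -hr2
  have hmB : |m| < B := by
    refine lt_of_pow_lt_pow_left₀ 2 (Real.sqrt_nonneg _) ?_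
    rw [sq_abs, hB2]; linarith
  have hm0 : m ≠ 0 := by rintro rfl; norm_num at hm
  have hA0 : 0 < A := Real.sqrt_pos.2 (by linarith)
  have hD : 0 < |m| * A ^ 2 * (B - |m|) ^ 2 := by
    have : 0 < B - |m| := by linarith
    positivity
  set D := |m| * A ^ 2 * (B - |m|) ^ 2
  set K := √(3 + 2 * m ^ 2) with hK
  have hK0 : 0 < K := Real.sqrt_pos.2 (by positivity)
  refine ⟨min (1 / 3) (min (1 / K ^ 3) (D / (4 * K ^ 9))), by positivity, ?_⟩
  intro T η p q h
  have hT := h.re_pos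
  have hP : 0 ≤ T.re * √(‖T‖ ^ 2 + η ^ 2) * ‖p‖ := by positivity
  rcases le_total (m ^ 2 * η ^ 2) (T.im ^ 2) with hs | hs
  · refine (mul_le_mul_of_nonneg_right (min_le_left _ _) hP).trans ?_
    calc _ = (1 / 3) * T.re * √(‖T‖ ^ 2 + η ^ 2) * ‖p‖ := by ring
      _ ≤ _ := mul_le_mul (h.bound_of_le hm hs) (h.norm_p_le_norm_add hs) (norm_nonneg _)
        (norm_nonneg _)
  · rcases le_total (2 * η ^ 2) (T.re ^ 2) with hη | hη
    · refine (mul_le_mul_of_nonneg_right ((min_le_right _ _).trans (min_le_left _ _)) hP).trans ?_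
      rw [one_div_mul_eq_div, div_le_iff₀ (by positivity), mul_comm _ (K ^ 3)]
      exact h.bound_of_two_mul_sq_le hs hη
    · refine (mul_le_mul_of_nonneg_right ((min_le_right _ _).trans (min_le_right _ _)) hP).trans ?_
      rw [div_mul_eq_mul_div, div_le_iff₀ (by positivity), mul_comm _ (4 * K ^ 9)]
      exact h.bound_of_sq_le_two_mul hAB hAB' hmB.le hs hη

/-- Replacing `m` by `-m` exchanges the roots, so the bound for `q` follows from that for `p`. -/
theorem exists_bound {m : ℝ} (hm : 2 < m ^ 2) :
    ∃ k : ℝ, 0 < k ∧ ∀ {T : ℂ} {η : ℝ} {p q : ℂ}, RootPair m T η p q →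
      k * (T.re * √(‖T‖ ^ 2 + η ^ 2) * ‖p‖) ≤ ‖p * q - (η : ℂ) ^ 2‖ * ‖p + q‖ ∧
      k * (T.re * √(‖T‖ ^ 2 + η ^ 2) * ‖q‖) ≤ ‖p * q - (η : ℂ) ^ 2‖ * ‖p + q‖ := by
  obtain ⟨k₁, hk₁, h₁⟩ := exists_bound_p hm
  obtain ⟨k₂, hk₂, h₂⟩ := exists_bound_p (m := -m) (by simpa using hm)
  refine ⟨min k₁ k₂, lt_min hk₁ hk₂, fun {T η p q} h => ?_⟩
  have hT := h.re_pos
  refine ⟨(mul_le_mul_of_nonneg_right (min_le_left _ _) (by positivity)).trans (h₁ h),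
    (mul_le_mul_of_nonneg_right (min_le_right _ _) (by positivity)).trans ?_⟩
  rw [mul_comm p q, add_comm p q]
  exact h₂ h.symm

end RootPair

/-! ### The symbol bound in the original variables -/

theorem muPlus_re_pos (v : ℝ) {c : ℝ} (hc : 0 < c) {τ : ℂ} (hτ : 0 < τ.re) (η : ℝ) :
    0 < (muPlus v c τ η).re := root_re_pos v c 1 hc τ hτ η

theorem muMinus_re_pos (v : ℝ) {c : ℝ} (hc : 0 < c) {τ : ℂ} (hτ : 0 < τ.re) (η : ℝ) :
    0 < (muMinus v c τ η).re := root_re_pos v c (-1) hc τ hτ η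

theorem rootPair_mu (v : ℝ) {c : ℝ} (hc : 0 < c) {τ : ℂ} (hτ : 0 < τ.re) (η : ℝ) :
    RootPair (v / c) (τ / c) η (muPlus v c τ η) (muMinus v c τ η) where
  re_pos := by rw [Complex.div_ofReal_re]; positivity
  p_re := muPlus_re_pos v hc hτ η
  q_re := muMinus_re_pos v hc hτ η
  p_sq := by
    rw [muPlus, root_sq, radicand]; push_cast; ring
  q_sq := by
    rw [muMinus, root_sq, radicand]; push_cast; ring

theorem symbol_eq (v : ℝ) {c : ℝ} (hc : 0 < c) {τ : ℂ} (hτ : 0 < τ.re) (η : ℝ) :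
    symbol v c τ η = (c : ℂ) ^ 2 * (muPlus v c τ η * muMinus v c τ η - (η : ℂ) ^ 2) := by
  rw [← (rootPair_mu v hc hτ η).symbol_eq, symbol]
  have : (c : ℂ) ≠ 0 := by exact_mod_cast hc.ne'
  push_cast
  field_simp

/-- The lower bound for the symbol, weighted by the sum of the two roots. -/
theorem exists_symbol_bound {v c : ℝ} (hc : 0 < c) (hM : √2 < v / c) :
    ∃ k : ℝ, 0 < k ∧ ∀ γ : ℝ, 0 < γ → ∀ ξ : Plane,
      k * (γ * Lam γ ξ) * ‖muPlus v c (tau γ (ξ 0)) (ξ 1)‖ ≤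
        ‖symbol v c (tau γ (ξ 0)) (ξ 1)‖ *
          ‖muPlus v c (tau γ (ξ 0)) (ξ 1) + muMinus v c (tau γ (ξ 0)) (ξ 1)‖ ∧
      k * (γ * Lam γ ξ) * ‖muMinus v c (tau γ (ξ 0)) (ξ 1)‖ ≤
        ‖symbol v c (tau γ (ξ 0)) (ξ 1)‖ *
          ‖muPlus v c (tau γ (ξ 0)) (ξ 1) + muMinus v c (tau γ (ξ 0)) (ξ 1)‖ := by
  have hm : 2 < (v / c) ^ 2 := by
    have := pow_lt_pow_left₀ hM (Real.sqrt_nonneg _) two_ne_zero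
    rwa [Real.sq_sqrt zero_le_two] at this
  obtain ⟨k, hk, hb⟩ := RootPair.exists_bound hm
  -- `c ^ 2` comes from the symbol, `1 / c` from `Re T = γ / c`, and the minimum from comparing the
  -- frequency norm of `(T, η)` with `Λ`.
  refine ⟨c ^ 2 * k * (1 / c * min (1 / c) 1), by positivity, fun γ hγ ξ => ?_⟩
  have hτ : 0 < (tau γ (ξ 0)).re := by simpa [tau] using hγ
  rw [symbol_eq v hc hτ, norm_mul]
  obtain ⟨h1, h2⟩ := hb (rootPair_mu v hc hτ (ξ 1))
  have hre : (tau γ (ξ 0) / c).re = γ / c := by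
    rw [Complex.div_ofReal_re]; simp [tau]
  have hnorm : ‖tau γ (ξ 0) / c‖ ^ 2 = (γ ^ 2 + ξ 0 ^ 2) / c ^ 2 := by
    rw [norm_div, div_pow, ← Complex.normSq_eq_norm_sq, Complex.normSq_apply]
    simp [tau]; ring
  have hN : min (1 / c) 1 * Lam γ ξ ≤ √(‖tau γ (ξ 0) / c‖ ^ 2 + ξ 1 ^ 2) := by
    refine Real.le_sqrt_of_sq_le ?_
    rw [mul_pow, Lam, Real.sq_sqrt (by positivity), hnorm]
    have e0 : 0 ≤ min (1 / c) 1 := by positivity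
    have e1 : min (1 / c) 1 ^ 2 ≤ 1 / c ^ 2 := by
      rw [← one_div_pow]; gcongr; exact min_le_left _ _
    have e2 : min (1 / c) 1 ^ 2 ≤ 1 := pow_le_one₀ e0 (min_le_right _ _)
    calc min (1 / c) 1 ^ 2 * (γ ^ 2 + ξ 0 ^ 2 + ξ 1 ^ 2)
        = min (1 / c) 1 ^ 2 * (γ ^ 2 + ξ 0 ^ 2) + min (1 / c) 1 ^ 2 * ξ 1 ^ 2 := by ring
      _ ≤ 1 / c ^ 2 * (γ ^ 2 + ξ 0 ^ 2) + 1 * ξ 1 ^ 2 := by gcongr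
      _ = _ := by ring
  rw [hre] at h1 h2
  have hc2 : ‖(c : ℂ) ^ 2‖ = c ^ 2 := by simp
  rw [hc2]
  have key : ∀ {x Y : ℝ}, 0 ≤ x →
      k * (γ / c * √(‖tau γ (ξ 0) / c‖ ^ 2 + ξ 1 ^ 2) * x) ≤ Y →
      c ^ 2 * k * (1 / c * min (1 / c) 1) * (γ * Lam γ ξ) * x ≤ c ^ 2 * Y := by
    intro x Y hx hY
    calc c ^ 2 * k * (1 / c * min (1 / c) 1) * (γ * Lam γ ξ) * x
        = c ^ 2 * (k * (γ / c * (min (1 / c) 1 * Lam γ ξ) * x)) := by ring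
      _ ≤ c ^ 2 * (k * (γ / c * √(‖tau γ (ξ 0) / c‖ ^ 2 + ξ 1 ^ 2) * x)) := by gcongr
      _ ≤ _ := by gcongr
  constructor
  · linarith [key (norm_nonneg _) h1]
  · linarith [key (norm_nonneg _) h2]

/-! ### Density of test functions in the Schwartz space -/

section Density

variable {E : Type*} [NormedAddCommGroup E] [NormedSpace ℝ E]

/-- Products of a Schwartz function with dilated cutoff functions converge to that function. -/
theorem tendsto_smulLeftCLM_cutoff {χ : E → ℝ}
    (hχ : ContDiff ℝ ((⊤ : ℕ∞) : WithTop ℕ∞) χ) (hχc : HasCompactSupport χ)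
    (hχ1 : ∀ x : E, ‖x‖ < 1 → χ x = 1) (f : 𝓢(E, ℂ)) :
    Filter.Tendsto
      (fun n : ℕ => SchwartzMap.smulLeftCLM ℂ (fun x : E => χ (((n : ℝ) + 1)⁻¹ • x)) f)
      Filter.atTop (nhds f) := by
  rw [(schwartz_withSeminorms ℝ E ℂ).tendsto_nhds]
  rintro ⟨k, l⟩ ε hε
  set X : 𝓢(E, ℝ) := hχc.toSchwartzMap hχ with hX
  have hXχ : ∀ x, X x = χ x := fun x => rfl
  -- Leibniz bound with one extra power of `‖x‖`: the difference lives where `‖x‖ ≥ n + 1`, so this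
  -- power yields decay `1 / (n + 1)`.
  set M : ℝ := (∑ i ∈ Finset.range (l + 1), (l.choose i : ℝ) *
    SchwartzMap.seminorm ℝ 0 i X * SchwartzMap.seminorm ℝ (k + 1) (l - i) f) +
    SchwartzMap.seminorm ℝ (k + 1) l f with hM
  have hM0 : 0 ≤ M := by
    refine add_nonneg (Finset.sum_nonneg fun i _ => ?_) (apply_nonneg _ _)
    exact mul_nonneg (mul_nonneg (by positivity) (apply_nonneg _ _)) (apply_nonneg _ _)
  have hbound : ∀ n : ℕ, SchwartzMap.seminorm ℝ k l
      (SchwartzMap.smulLeftCLM ℂ (fun x : E => χ (((n : ℝ) + 1)⁻¹ • x)) f - f) ≤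
        M / ((n : ℝ) + 1) := by
    intro n
    set a : ℝ := ((n : ℝ) + 1)⁻¹ with ha
    have ha0 : 0 < a := by positivity
    have ha1 : a ≤ 1 := inv_le_one_of_one_le₀ (by linarith [(n.cast_nonneg : (0 : ℝ) ≤ n)])
    have hs : ContDiff ℝ ((⊤ : ℕ∞) : WithTop ℕ∞) (fun x : E => χ (a • x)) := by fun_prop
    have hc : HasCompactSupport (fun x : E => χ (a • x)) := hχc.comp_smul ha0.ne'
    have hg : (fun x : E => χ (a • x)).HasTemperateGrowth := hc.hasTemperateGrowth hs
    have hderiv : ∀ (i : ℕ) (x : E), ‖iteratedFDeriv ℝ i (fun x : E => χ (a • x)) x‖ ≤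
        SchwartzMap.seminorm ℝ 0 i X := by
      intro i x
      rw [iteratedFDeriv_comp_const_smul a (hχ.of_le (by exact_mod_cast le_top)), norm_smul,
        norm_pow, Real.norm_of_nonneg ha0.le]
      have h1 : ‖iteratedFDeriv ℝ i χ (a • x)‖ ≤ SchwartzMap.seminorm ℝ 0 i X :=
        SchwartzMap.norm_iteratedFDeriv_le_seminorm ℝ X i (a • x)
      calc a ^ i * ‖iteratedFDeriv ℝ i χ (a • x)‖ ≤ 1 * ‖iteratedFDeriv ℝ i χ (a • x)‖ := by
            gcongr; exact pow_le_one₀ ha0.le ha1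
        _ ≤ _ := by rw [one_mul]; exact h1
    have hcoe : ⇑(SchwartzMap.smulLeftCLM ℂ (fun x : E => χ (a • x)) f - f) =
        (fun x : E => χ (a • x) • f x) - ⇑f := by
      ext x
      simp [SchwartzMap.smulLeftCLM_apply_apply hg]
    refine SchwartzMap.seminorm_le_bound ℝ k l _ (by positivity) fun x => ?_
    rw [hcoe]
    by_cases hx : ‖x‖ < (n : ℝ) + 1
    · have hev : ((fun x : E => χ (a • x) • f x) - ⇑f) =ᶠ[nhds x] fun _ => 0 := by
        have : ∀ᶠ y in nhds x, ‖y‖ < (n : ℝ) + 1 :=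
          (isOpen_lt continuous_norm continuous_const).mem_nhds hx
        filter_upwards [this] with y hy
        have : ‖a • y‖ < 1 := by
          rw [norm_smul, Real.norm_of_nonneg ha0.le, ha, inv_mul_lt_iff₀ (by positivity)]
          simpa using hy
        simp [hχ1 _ this]
      rw [(Filter.EventuallyEq.iteratedFDeriv ℝ hev l).eq_of_nhds]
      have : iteratedFDeriv ℝ l (fun _ : E => (0 : ℂ)) x = 0 := by
        simp
      rw [this]
      simpa using by positivity
    · push Not at hx
      have hd : iteratedFDeriv ℝ l ((fun x : E => χ (a • x) • f x) - ⇑f) x =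
          iteratedFDeriv ℝ l (fun x : E => χ (a • x) • f x) x - iteratedFDeriv ℝ l f x := by
        apply iteratedFDeriv_sub_apply
        · exact ((hs.smul (f.smooth ⊤)).of_le (by exact_mod_cast le_top)).contDiffAt
        · exact ((f.smooth ⊤).of_le (by exact_mod_cast le_top)).contDiffAt
      rw [hd, le_div_iff₀ (by positivity)]
      have hL : ‖x‖ ^ (k + 1) * ‖iteratedFDeriv ℝ l (fun x : E => χ (a • x) • f x) x‖ ≤
          ∑ i ∈ Finset.range (l + 1), (l.choose i : ℝ) *
            SchwartzMap.seminorm ℝ 0 i X * SchwartzMap.seminorm ℝ (k + 1) (l - i) f := by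
        calc _ ≤ ‖x‖ ^ (k + 1) * ∑ i ∈ Finset.range (l + 1), (l.choose i : ℝ) *
              ‖iteratedFDeriv ℝ i (fun x : E => χ (a • x)) x‖ * ‖iteratedFDeriv ℝ (l - i) f x‖ := by
              gcongr
              exact norm_iteratedFDeriv_smul_le hs (f.smooth ⊤) x (by exact_mod_cast le_top)
          _ = ∑ i ∈ Finset.range (l + 1), (l.choose i : ℝ) *
              ‖iteratedFDeriv ℝ i (fun x : E => χ (a • x)) x‖ *
                (‖x‖ ^ (k + 1) * ‖iteratedFDeriv ℝ (l - i) f x‖) := by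
              rw [Finset.mul_sum]
              exact Finset.sum_congr rfl fun i _ => by ring
          _ ≤ _ := by
              refine Finset.sum_le_sum fun i _ => ?_
              have := hderiv i x
              have := SchwartzMap.le_seminorm ℝ (k + 1) (l - i) f x
              gcongr
      have hR := SchwartzMap.le_seminorm ℝ (k + 1) l f x
      calc ‖x‖ ^ k * ‖iteratedFDeriv ℝ l (fun x : E => χ (a • x) • f x) x -
              iteratedFDeriv ℝ l f x‖ * ((n : ℝ) + 1)
          ≤ ‖x‖ ^ k * (‖iteratedFDeriv ℝ l (fun x : E => χ (a • x) • f x) x‖ +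
              ‖iteratedFDeriv ℝ l f x‖) * ‖x‖ := by
            gcongr
            exact norm_sub_le _ _
        _ = ‖x‖ ^ (k + 1) * ‖iteratedFDeriv ℝ l (fun x : E => χ (a • x) • f x) x‖ +
              ‖x‖ ^ (k + 1) * ‖iteratedFDeriv ℝ l f x‖ := by ring
        _ ≤ M := add_le_add hL hR
  have hlim : Filter.Tendsto (fun n : ℕ => M / ((n : ℝ) + 1)) Filter.atTop (nhds 0) :=
    tendsto_const_nhds.div_atTop
      (Filter.tendsto_atTop_add_const_right _ _ tendsto_natCast_atTop_atTop)
  filter_upwards [hlim.eventually (gt_mem_nhds hε)] with n hn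
  exact (hbound n).trans_lt hn

end Density

/-- A smooth compactly supported real function as a test function on the plane. -/
def mkTest (g : Plane → ℝ) (hg : ContDiff ℝ ((⊤ : ℕ∞) : WithTop ℕ∞) g)
    (hc : HasCompactSupport g) : 𝓓((⊤ : TopologicalSpace.Opens Plane), ℝ) where
  toFun := g
  contDiff' := hg
  hasCompactSupport' := hc
  tsupport_subset' := by simp

@[simp] theorem testToSchwartz_apply (φ : 𝓓((⊤ : TopologicalSpace.Opens Plane), ℝ)) (x : Plane) :
    testToSchwartz φ x = ((φ x : ℝ) : ℂ) := rfl

@[simp] theorem mkTest_apply (g : Plane → ℝ) (hg : ContDiff ℝ ((⊤ : ℕ∞) : WithTop ℕ∞) g)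
    (hc : HasCompactSupport g) (x : Plane) : mkTest g hg hc x = g x := rfl

@[simp] theorem expMul_apply (γ : ℝ) (φ : 𝓓((⊤ : TopologicalSpace.Opens Plane), ℝ)) (x : Plane) :
    expMul γ φ x = Real.exp (-γ * x 0) * φ x := rfl

theorem expMul_expMul_neg (γ : ℝ) (φ : 𝓓((⊤ : TopologicalSpace.Opens Plane), ℝ)) :
    expMul γ (expMul (-γ) φ) = φ := by
  ext x
  rw [expMul_apply, expMul_apply, ← mul_assoc, ← Real.exp_add]
  simp

/-- A tempered distribution is determined by its values on test functions. -/
theorem temperedDistribution_eq_zero {T : 𝓢'(Plane, ℂ)}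
    (hT : ∀ φ : 𝓓((⊤ : TopologicalSpace.Opens Plane), ℝ), T (testToSchwartz φ) = 0) : T = 0 := by
  have hcompact : ∀ f : 𝓢(Plane, ℂ), HasCompactSupport f → T f = 0 := by
    intro f hf
    set φr := mkTest (fun x => (f x).re) (Complex.reCLM.contDiff.comp (f.smooth ⊤))
      (hf.comp_left (g := Complex.re) Complex.zero_re)
    set φi := mkTest (fun x => (f x).im) (Complex.imCLM.contDiff.comp (f.smooth ⊤))
      (hf.comp_left (g := Complex.im) Complex.zero_im)
    -- Test functions are real valued, so a complex one is split into real and imaginary parts.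
    have : f = testToSchwartz φr + Complex.I • testToSchwartz φi := by
      ext x
      simp only [add_apply, smul_apply, testToSchwartz_apply, φr, φi, smul_eq_mul]
      rw [mul_comm]
      exact (Complex.re_add_im _).symm
    rw [this, map_add, map_smul, hT, hT]
    simp
  ext f
  set χ : ContDiffBump (0 : Plane) := ⟨1, 2, one_pos, one_lt_two⟩
  have hlim := tendsto_smulLeftCLM_cutoff (χ := χ) χ.contDiff χ.hasCompactSupport
    (fun x hx => χ.one_of_mem_closedBall (by simpa [χ] using hx.le)) f
  have hlim' := (T.continuous.tendsto f).comp hlim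
  refine tendsto_nhds_unique hlim' ?_
  refine tendsto_const_nhds.congr fun n => ?_
  have hpos : ((n : ℝ) + 1)⁻¹ ≠ 0 := by positivity
  have hc : HasCompactSupport (fun x : Plane => χ (((n : ℝ) + 1)⁻¹ • x)) :=
    χ.hasCompactSupport.comp_smul hpos
  have hs : ContDiff ℝ ((⊤ : ℕ∞) : WithTop ℕ∞) (fun x : Plane => χ (((n : ℝ) + 1)⁻¹ • x)) :=
    χ.contDiff.comp (contDiff_const_smul _)
  refine (hcompact _ ?_).symm
  rw [SchwartzMap.smulLeftCLM_apply (hc.hasTemperateGrowth hs)]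
  exact hc.smul_right

/-! ### Uniqueness of the Fourier transform -/

theorem IsExpWeighted.unique {γ : ℝ} {u : PlaneDistribution} {T T' : 𝓢'(Plane, ℂ)}
    (h : IsExpWeighted γ u T) (h' : IsExpWeighted γ u T') : T = T' := by
  refine sub_eq_zero.1 (temperedDistribution_eq_zero fun φ => ?_)
  have := (h φ).symm.trans (h' φ)
  exact sub_eq_zero.2 this

theorem IsExpWeighted.eq {γ : ℝ} {u u' : PlaneDistribution} {T : 𝓢'(Plane, ℂ)}
    (h : IsExpWeighted γ u T) (h' : IsExpWeighted γ u' T) : u = u' := by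
  ext φ
  rw [← expMul_expMul_neg γ φ, h, h']

/-- Pairing with a test function equal to `1` on a given compact set turns integrability of products
into local integrability. -/
theorem HasFourierFun.locallyIntegrable {T : 𝓢'(Plane, ℂ)} {w : Plane → ℂ}
    (h : HasFourierFun T w) : LocallyIntegrable fun ξ => w ((2 * Real.pi) • ξ) := by
  rw [locallyIntegrable_iff]
  intro K hK
  obtain ⟨R, hR, hKR⟩ := hK.isBounded.subset_closedBall_lt 0 (0 : Plane)
  set χ : ContDiffBump (0 : Plane) := ⟨R, R + 1, hR, by linarith⟩
  have hχ := (h (testToSchwartz (mkTest χ χ.contDiff χ.hasCompactSupport))).1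
  refine (hχ.integrableOn (s := K)).congr_fun (fun ξ hξ => ?_) hK.measurableSet
  have : χ ξ = 1 := χ.one_of_mem_closedBall (hKR hξ)
  simp [this]

theorem ae_comp_smul_iff {a : ℝ} (ha : a ≠ 0) {P : Plane → Prop} :
    (∀ᵐ ξ : Plane, P (a • ξ)) ↔ ∀ᵐ ξ : Plane, P ξ := by
  have key : ∀ {a : ℝ}, a ≠ 0 → ∀ {P : Plane → Prop}, (∀ᵐ ξ : Plane, P ξ) →
      ∀ᵐ ξ : Plane, P (a • ξ) := by
    intro a ha P h
    have := Measure.quasiMeasurePreserving_smul (volume : Measure Plane) ha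
    exact this.ae h
  refine ⟨fun h => ?_, key ha⟩
  have := key (inv_ne_zero ha) h
  simpa [smul_smul, ha] using this

theorem HasFourierFun.ae_eq {T : 𝓢'(Plane, ℂ)} {w w' : Plane → ℂ}
    (h : HasFourierFun T w) (h' : HasFourierFun T w') : w =ᵐ[volume] w' := by
  have := ae_eq_of_integral_contDiff_smul_eq h.locallyIntegrable h'.locallyIntegrable
    (fun g hg hc => ?_)
  · exact (ae_comp_smul_iff (P := fun ξ => w ξ = w' ξ) Real.two_pi_pos.ne').1 this
  · have e := (h (testToSchwartz (mkTest g hg hc))).2.symm.trans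
      (h' (testToSchwartz (mkTest g hg hc))).2
    simpa [mul_comm] using e

theorem HasFourierFun.congr {T : 𝓢'(Plane, ℂ)} {w w' : Plane → ℂ}
    (h : HasFourierFun T w) (hw : w =ᵐ[volume] w') : HasFourierFun T w' := by
  intro φ
  have : (fun ξ : Plane => w ((2 * Real.pi) • ξ) * φ ξ) =ᵐ[volume]
      fun ξ : Plane => w' ((2 * Real.pi) • ξ) * φ ξ := by
    filter_upwards [(ae_comp_smul_iff (P := fun ξ => w ξ = w' ξ) Real.two_pi_pos.ne').2 hw] with ξ hξ
    rw [hξ]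
  exact ⟨(h φ).1.congr this, (h φ).2.trans (integral_congr_ae this)⟩

theorem HasFourierFun.eq {T T' : 𝓢'(Plane, ℂ)} {w : Plane → ℂ}
    (h : HasFourierFun T w) (h' : HasFourierFun T' w) : T = T' := by
  have : 𝓕 T = 𝓕 T' := by
    ext φ
    rw [(h φ).2, (h' φ).2]
  simpa using congrArg 𝓕⁻ this

theorem IsHat.ae_eq {γ : ℝ} {u : PlaneDistribution} {w w' : Plane → ℂ}
    (h : IsHat γ u w) (h' : IsHat γ u w') : w =ᵐ[volume] w' := by
  obtain ⟨T, hT, hw⟩ := h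
  obtain ⟨T', hT', hw'⟩ := h'
  obtain rfl := hT.unique hT'
  exact hw.ae_eq hw'

theorem IsHat.congr {γ : ℝ} {u : PlaneDistribution} {w w' : Plane → ℂ}
    (h : IsHat γ u w) (hw : w =ᵐ[volume] w') : IsHat γ u w' := by
  obtain ⟨T, hT, hT'⟩ := h
  exact ⟨T, hT, hT'.congr hw⟩

theorem IsHat.eq {γ : ℝ} {u u' : PlaneDistribution} {w : Plane → ℂ}
    (h : IsHat γ u w) (h' : IsHat γ u' w) : u = u' := by
  obtain ⟨T, hT, hw⟩ := h
  obtain ⟨T', hT', hw'⟩ := h'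
  obtain rfl := hw.eq hw'
  exact hT.eq hT'

/-- The infimum defining `normSq` runs over almost everywhere equal functions, so any representative
computes it. -/
theorem IsHat.normSq_eq {γ s : ℝ} {u : PlaneDistribution} {w : Plane → ℂ} (h : IsHat γ u w) :
    normSq γ s u = ENNReal.ofReal (1 / (2 * Real.pi) ^ 2) *
      ∫⁻ ξ : Plane, ENNReal.ofReal (Lam γ ξ ^ (2 * s) * ‖w ξ‖ ^ 2) := by
  refine le_antisymm (iInf₂_le w h) (le_iInf₂ fun w' h' => ?_)
  refine le_of_eq ?_
  congr 1
  refine lintegral_congr_ae ?_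
  filter_upwards [h.ae_eq h'] with ξ hξ
  rw [hξ]

/-! ### Distributions with a prescribed Fourier transform -/

/-- The inclusion of the smooth functions supported in a compact set into the Schwartz space. -/
def supportedInToSchwartz (K : TopologicalSpace.Compacts Plane) :
    ContDiffMapSupportedIn Plane ℝ ⊤ K →ₗ[ℝ] 𝓢(Plane, ℂ) where
  toFun φ := testToSchwartz (TestFunction.ofSupportedIn (by simp) φ)
  map_add' φ ψ := by ext x; simp
  map_smul' a φ := by ext x; simp

/-- On a fixed compact set polynomial weights are bounded by `R ^ k`, so each Schwartz seminorm is
controlled by one derivative seminorm. -/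
theorem continuous_supportedInToSchwartz (K : TopologicalSpace.Compacts Plane) :
    Continuous (supportedInToSchwartz K) := by
  refine WithSeminorms.continuous_of_isBounded (ContDiffMapSupportedIn.withSeminorms ℝ _ _ _ _)
    (schwartz_withSeminorms ℝ Plane ℂ) _ (.of_real ?_)
  rintro ⟨k, l⟩
  obtain ⟨R, hR, hKR⟩ := K.isCompact.isBounded.subset_closedBall_lt 0 (0 : Plane)
  refine ⟨{l}, R ^ k, fun φ => ?_⟩
  rw [Finset.sup_singleton]
  refine SchwartzMap.seminorm_le_bound ℝ k l _
    (mul_nonneg (by positivity) (apply_nonneg _ _)) fun x => ?_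
  have hcoe : ⇑(supportedInToSchwartz K φ) = Complex.ofRealLI ∘ φ := rfl
  rw [hcoe, Complex.ofRealLI.norm_iteratedFDeriv_comp_left
    (φ.contDiff.contDiffAt) (by exact_mod_cast le_top)]
  by_cases hx : x ∈ K
  · have h1 : ‖x‖ ≤ R := by simpa using hKR hx
    have h2 := ContDiffMapSupportedIn.norm_iteratedFDeriv_apply_le_seminorm_top (i := l) ℝ
      (f := φ) (x := x)
    gcongr
  · have h0 : iteratedFDeriv ℝ l φ x = 0 := φ.iteratedFDeriv_zero_on_compl hx
    rw [h0, norm_zero, mul_zero]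
    exact mul_nonneg (by positivity) (apply_nonneg _ _)

/-- The distribution `e^{γ t} T`. -/
def expWeight (γ : ℝ) (T : 𝓢'(Plane, ℂ)) : PlaneDistribution :=
  TestFunction.mkCLM ℝ (fun φ => T (testToSchwartz (expMul (-γ) φ)))
    (fun φ ψ => by
      rw [← map_add]
      congr 1
      ext x
      simp [mul_add])
    (fun a φ => by
      have : testToSchwartz (expMul (-γ) (a • φ)) =
          (a : ℂ) • testToSchwartz (expMul (-γ) φ) := by
        ext x
        simp [mul_left_comm]
      rw [this, map_smul]
      simp)
    -- Continuity is checked on each compact support, where multiplication by the smooth exponential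
    -- is continuous.
    (fun K hK => by
      have hexp : ContDiff ℝ ((⊤ : ℕ∞) : WithTop ℕ∞)
          (fun x : Plane => Real.exp (-(-γ) * x 0)) := by fun_prop
      have hcont := (T.continuous.comp (continuous_supportedInToSchwartz K)).comp
        (ContDiffMapSupportedIn.bilinLeftCLM (K := K) (n := ⊤) (ContinuousLinearMap.mul ℝ ℝ)
          hexp).continuous
      refine hcont.congr fun φ => ?_
      change T _ = T _
      congr 1
      ext x
      change ((φ x * Real.exp (-(-γ) * x 0) : ℝ) : ℂ) = ((Real.exp (-(-γ) * x 0) * φ x : ℝ) : ℂ)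
      rw [mul_comm])

theorem isExpWeighted_expWeight (γ : ℝ) (T : 𝓢'(Plane, ℂ)) :
    IsExpWeighted γ (expWeight γ T) T := by
  intro φ
  change T (testToSchwartz (expMul (-γ) (expMul γ φ))) = _
  have := expMul_expMul_neg (-γ) φ
  rw [neg_neg] at this
  rw [this]

/-! ### Comparison of the Sobolev weights -/

theorem Lam_pos {γ : ℝ} (hγ : 0 < γ) (ξ : Plane) : 0 < Lam γ ξ := Real.sqrt_pos.2 (by positivity)

theorem Lam_rpow {γ : ℝ} (s : ℝ) (ξ : Plane) :
    Lam γ ξ ^ (2 * s) = (γ ^ 2 + ‖ξ‖ ^ 2) ^ s := by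
  rw [Lam, Real.rpow_mul (Real.sqrt_nonneg _), Real.rpow_two, Real.sq_sqrt (by positivity),
    EuclideanSpace.norm_sq_eq]
  simp [add_assoc]

theorem continuous_Lam (γ : ℝ) : Continuous (Lam γ) := by
  unfold Lam
  fun_prop

/-- The weights of Mathlib's Sobolev spaces are controlled by `Λ`. -/
theorem exists_bracket_le {γ : ℝ} (hγ : 1 ≤ γ) (s : ℝ) :
    ∃ K : ℝ, ∀ ξ : Plane,
      (1 + ‖ξ‖ ^ 2) ^ s ≤ K * Lam γ ((2 * Real.pi) • ξ) ^ (2 * s) := by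
  have hpi : (1 : ℝ) ≤ (2 * Real.pi) ^ 2 := by nlinarith [Real.pi_gt_three]
  have hγ2 : 1 ≤ γ ^ 2 := by nlinarith
  set Q : ℝ := γ ^ 2 + (2 * Real.pi) ^ 2 with hQ
  -- For `s ≥ 0` the constant `1` works because `γ ≥ 1`; for `s ≤ 0` the weight `Λ²` is at most `Q
  -- (1 + ‖ξ‖²)`.
  refine ⟨max 1 (Q ^ (-s)), fun ξ => ?_⟩
  rw [Lam_rpow, norm_smul, mul_pow, Real.norm_of_nonneg Real.two_pi_pos.le]
  have hx : 0 ≤ ‖ξ‖ ^ 2 := by positivity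
  set x := ‖ξ‖ ^ 2
  set P := (2 * Real.pi) ^ 2
  have hb : 0 ≤ (γ ^ 2 + P * x) ^ s := by positivity
  rcases le_total 0 s with hs | hs
  · calc (1 + x) ^ s ≤ (γ ^ 2 + P * x) ^ s := by
          gcongr
          nlinarith
      _ ≤ max 1 (Q ^ (-s)) * (γ ^ 2 + P * x) ^ s := le_mul_of_one_le_left hb (le_max_left _ _)
  · have h1 : (Q * (1 + x)) ^ s ≤ (γ ^ 2 + P * x) ^ s := by
      refine Real.rpow_le_rpow_of_nonpos (by positivity) ?_ hs
      rw [hQ]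
      nlinarith
    rw [Real.mul_rpow (by positivity) (by positivity)] at h1
    calc (1 + x) ^ s = Q ^ (-s) * (Q ^ s * (1 + x) ^ s) := by
          rw [← mul_assoc, ← Real.rpow_add (by positivity)]
          simp
      _ ≤ Q ^ (-s) * (γ ^ 2 + P * x) ^ s := by gcongr
      _ ≤ _ := by gcongr; exact le_max_right _ _

/-- The weight `(1 + ‖ξ‖²)^{r/2}`, complex valued. -/
def bracket (r : ℝ) (ξ : Plane) : ℂ := (((1 + ‖ξ‖ ^ 2) ^ (r / 2) : ℝ) : ℂ)

theorem hasTemperateGrowth_bracket (r : ℝ) : (bracket r).HasTemperateGrowth := by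
  unfold bracket
  fun_prop

theorem bracket_mul_neg (r : ℝ) (ξ : Plane) : bracket r ξ * bracket (-r) ξ = 1 := by
  unfold bracket
  rw [← Complex.ofReal_mul, ← Real.rpow_add (by positivity)]
  simp [neg_div]

theorem memLp_bracket_mul {γ : ℝ} (hγ : 1 ≤ γ) (s : ℝ) {w : Plane → ℂ}
    (hw : AEStronglyMeasurable w)
    (hfin : ∫⁻ ξ : Plane, ENNReal.ofReal (Lam γ ξ ^ (2 * s) * ‖w ξ‖ ^ 2) ≠ ∞) :
    MemLp (fun ξ : Plane => bracket s ξ * w ((2 * Real.pi) • ξ)) 2 := by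
  have hLam : Continuous fun ξ : Plane => Lam γ ξ ^ (2 * s) :=
    (continuous_Lam γ).rpow_const fun ξ => Or.inl (Lam_pos (by linarith) ξ).ne'
  have hint : Integrable (fun ξ : Plane => Lam γ ξ ^ (2 * s) * ‖w ξ‖ ^ 2) := by
    refine ⟨hLam.aestronglyMeasurable.mul (hw.norm.pow 2), ?_⟩
    rw [hasFiniteIntegral_iff_ofReal (Filter.Eventually.of_forall fun ξ =>
      mul_nonneg (Real.rpow_nonneg (Lam_pos (by linarith) ξ).le _) (sq_nonneg _))]
    exact hfin.lt_top
  have hint' := hint.comp_smul Real.two_pi_pos.ne'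
  obtain ⟨K, hK⟩ := exists_bracket_le hγ s
  have hmeas : AEStronglyMeasurable (fun ξ : Plane => bracket s ξ * w ((2 * Real.pi) • ξ)) :=
    (hasTemperateGrowth_bracket s).1.continuous.aestronglyMeasurable.mul
      (hw.comp_quasiMeasurePreserving
        (Measure.quasiMeasurePreserving_smul (volume : Measure Plane) Real.two_pi_pos.ne'))
  rw [memLp_two_iff_integrable_sq_norm hmeas]
  refine (hint'.const_mul K).mono' (hmeas.norm.pow 2) (Filter.Eventually.of_forall fun ξ => ?_)
  have hb : ‖bracket s ξ‖ ^ 2 = (1 + ‖ξ‖ ^ 2) ^ s := by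
    unfold bracket
    rw [Complex.norm_real, Real.norm_of_nonneg (by positivity), ← Real.rpow_two,
      ← Real.rpow_mul (by positivity)]
    congr 1
    ring
  rw [Real.norm_of_nonneg (by positivity), norm_mul, mul_pow, hb, ← mul_assoc]
  gcongr
  exact hK ξ

/-- Every measurable function of finite weighted norm is the Fourier transform of a distribution
in the corresponding Sobolev space. -/
theorem exists_memHs_isHat {γ : ℝ} (hγ : 1 ≤ γ) (s : ℝ) {w : Plane → ℂ}
    (hw : AEStronglyMeasurable w)
    (hfin : ∫⁻ ξ : Plane, ENNReal.ofReal (Lam γ ξ ^ (2 * s) * ‖w ξ‖ ^ 2) ≠ ∞) :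
    ∃ f : PlaneDistribution, MemHs γ s f ∧ IsHat γ f w := by
  have hL := memLp_bracket_mul hγ s hw hfin
  set h : Lp ℂ 2 (volume : Measure Plane) := hL.toLp _ with hh
  -- The rescaled `w` is only weighted `L²`; it becomes a tempered distribution as the bracket of
  -- order `-s` times the `L²` function `h`.
  set S : 𝓢'(Plane, ℂ) := TemperedDistribution.smulLeftCLM ℂ (bracket (-s)) h with hS
  have hFS : 𝓕 (𝓕⁻ S) = S := FourierTransform.fourier_fourierInv_eq S
  refine ⟨expWeight γ (𝓕⁻ S), ⟨𝓕⁻ S, isExpWeighted_expWeight γ _, ?_⟩,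
    ⟨𝓕⁻ S, isExpWeighted_expWeight γ _, fun φ => ?_⟩⟩
  · rw [TemperedDistribution.memSobolev_iff_exists_smulLeftCLM_fourier, hFS]
    refine ⟨h, ?_⟩
    change TemperedDistribution.smulLeftCLM ℂ (bracket s) S = _
    rw [hS, TemperedDistribution.smulLeftCLM_smulLeftCLM_apply (hasTemperateGrowth_bracket _)
      (hasTemperateGrowth_bracket _)]
    have : bracket (-s) * bracket s = fun _ => (1 : ℂ) := by
      ext ξ; rw [mul_comm]; exact bracket_mul_neg s ξ
    rw [this]
    simp
  · set ψ : 𝓢(Plane, ℂ) := SchwartzMap.smulLeftCLM ℂ (bracket (-s)) φ with hψ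
    have hψa : ∀ ξ, ψ ξ = bracket (-s) ξ * φ ξ := fun ξ => by
      rw [hψ, SchwartzMap.smulLeftCLM_apply_apply (hasTemperateGrowth_bracket _), smul_eq_mul]
    have hmul : ∀ ξ : Plane, (bracket s ξ * w ((2 * Real.pi) • ξ)) * ψ ξ =
        w ((2 * Real.pi) • ξ) * φ ξ := fun ξ => by
      rw [hψa]
      linear_combination (w ((2 * Real.pi) • ξ) * φ ξ) * bracket_mul_neg s ξ
    constructor
    · have := hL.integrable_mul (ψ.memLp 2)
      exact this.congr (Filter.Eventually.of_forall fun ξ => hmul ξ)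
    · rw [hFS, hS, TemperedDistribution.smulLeftCLM_apply_apply, Lp.toTemperedDistribution_apply]
      refine integral_congr_ae ?_
      filter_upwards [hL.coeFn_toLp] with ξ hξ
      rw [← hmul ξ, hh, hξ, smul_eq_mul, mul_comm]

/-! ### Jointly measurable versions of square integrable families -/

section Joint

variable {X Y : Type*} [MeasurableSpace X] [MeasurableSpace Y] {μ : Measure X} {ν : Measure Y}

theorem eLpNorm_two_eq {α ε : Type*} [MeasurableSpace α] [TopologicalSpace ε] [ENormedAddMonoid ε]
    (m : Measure α) (f : α → ε) :
    eLpNorm f 2 m = (∫⁻ x, ‖f x‖ₑ ^ 2 ∂m) ^ (1 / 2 : ℝ) := by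
  rw [eLpNorm_eq_lintegral_rpow_enorm_toReal two_ne_zero ENNReal.ofNat_ne_top]
  simp

theorem eLpNorm_two_sq {α ε : Type*} [MeasurableSpace α] [TopologicalSpace ε] [ENormedAddMonoid ε]
    (m : Measure α) (f : α → ε) :
    eLpNorm f 2 m ^ 2 = ∫⁻ x, ‖f x‖ₑ ^ 2 ∂m := by
  rw [eLpNorm_two_eq, ← ENNReal.rpow_natCast, ← ENNReal.rpow_mul]
  norm_num

/-- `G` is a jointly measurable version of the family `f`. -/
def IsVersion (μ : Measure X) (ν : Measure Y) (f : Y → Lp ℂ 2 μ) (G : X × Y → ℂ) : Prop :=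
  AEStronglyMeasurable G (μ.prod ν) ∧ ∀ᵐ y ∂ν, (fun x => G (x, y)) =ᵐ[μ] f y

theorem IsVersion.sub {f g : Y → Lp ℂ 2 μ} {G H : X × Y → ℂ} (hG : IsVersion μ ν f G)
    (hH : IsVersion μ ν g H) : IsVersion μ ν (f - g) (G - H) := by
  refine ⟨hG.1.sub hH.1, ?_⟩
  filter_upwards [hG.2, hH.2] with y h1 h2
  filter_upwards [h1, h2, Lp.coeFn_sub (f y) (g y)] with x e1 e2 e3
  simp only [Pi.sub_apply] at e3 ⊢
  rw [e3, ← e1, ← e2]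

theorem IsVersion.congr {f g : Y → Lp ℂ 2 μ} {G : X × Y → ℂ} (hG : IsVersion μ ν f G)
    (hfg : f =ᵐ[ν] g) : IsVersion μ ν g G := by
  refine ⟨hG.1, ?_⟩
  filter_upwards [hG.2, hfg] with y h1 h2
  rwa [← h2]

variable [SigmaFinite μ] [SigmaFinite ν]

theorem eLpNorm_prod {G : X × Y → ℂ} (hG : AEStronglyMeasurable G (μ.prod ν)) :
    eLpNorm G 2 (μ.prod ν) = eLpNorm (fun y => eLpNorm (fun x => G (x, y)) 2 μ) 2 ν := by
  rw [eLpNorm_two_eq, eLpNorm_two_eq]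
  simp only [enorm_eq_self]
  simp_rw [eLpNorm_two_sq]
  rw [lintegral_prod_symm _ (hG.enorm.pow_const 2)]

theorem aemeasurable_eLpNorm_slice {G : X × Y → ℂ} (hG : AEStronglyMeasurable G (μ.prod ν)) :
    AEMeasurable (fun y => eLpNorm (fun x => G (x, y)) 2 μ) ν := by
  simp_rw [eLpNorm_two_eq]
  have : AEMeasurable (fun z : X × Y => ‖G z‖ₑ ^ 2) (μ.prod ν) := hG.enorm.pow_const 2
  exact this.lintegral_prod_left'.pow_const _

theorem IsVersion.eLpNorm_eq {f : Y → Lp ℂ 2 μ} {G : X × Y → ℂ} (h : IsVersion μ ν f G) :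
    eLpNorm G 2 (μ.prod ν) = eLpNorm f 2 ν := by
  rw [eLpNorm_prod h.1, eLpNorm_two_eq, eLpNorm_two_eq]
  congr 1
  refine lintegral_congr_ae ?_
  filter_upwards [h.2] with y hy
  rw [eLpNorm_congr_ae hy, enorm_eq_self, Lp.enorm_def]

/-- Being a version passes to the limit: almost every slice of `G'` is within `A n y + B n y` of `f'
y` for every `n`, and the infimum over `n` has zero `L²` norm. Taking the infimum avoids extracting
a subsequence. -/
theorem isVersion_of_tendsto {f : ℕ → Y → Lp ℂ 2 μ} {f' : Y → Lp ℂ 2 μ} {G : ℕ → X × Y → ℂ}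
    {G' : X × Y → ℂ} (h : ∀ n, IsVersion μ ν (f n) (G n))
    (hf : ∀ n, AEStronglyMeasurable (f n) ν) (hf' : AEStronglyMeasurable f' ν)
    (hG' : AEStronglyMeasurable G' (μ.prod ν))
    (hlim : Filter.Tendsto (fun n => eLpNorm (f n - f') 2 ν) Filter.atTop (nhds 0))
    (hlim' : Filter.Tendsto (fun n => eLpNorm (G n - G') 2 (μ.prod ν)) Filter.atTop (nhds 0)) :
    IsVersion μ ν f' G' := by
  refine ⟨hG', ?_⟩
  set A : ℕ → Y → ℝ≥0∞ := fun n y => eLpNorm (fun x => (G n - G') (x, y)) 2 μ with hA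
  set B : ℕ → Y → ℝ≥0∞ := fun n y => ‖(f n - f') y‖ₑ with hB
  have hAm : ∀ n, AEMeasurable (A n) ν := fun n => aemeasurable_eLpNorm_slice ((h n).1.sub hG')
  have hBm : ∀ n, AEMeasurable (B n) ν := fun n => ((hf n).sub hf').enorm
  set H : Y → ℝ≥0∞ := fun y => ⨅ n, (A n + B n) y with hH
  have hHm : AEMeasurable H ν := AEMeasurable.iInf fun n => (hAm n).add (hBm n)
  have hle : ∀ n, eLpNorm H 2 ν ≤ eLpNorm (G n - G') 2 (μ.prod ν) + eLpNorm (f n - f') 2 ν := by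
    intro n
    have e2 : eLpNorm (f n - f') 2 ν = eLpNorm (B n) 2 ν := by
      rw [hB, eLpNorm_two_eq, eLpNorm_two_eq]; simp
    rw [eLpNorm_prod ((h n).1.sub hG'), e2]
    refine le_trans (eLpNorm_mono_enorm fun y => ?_)
      (eLpNorm_add_le (hAm n).aestronglyMeasurable (hBm n).aestronglyMeasurable one_le_two)
    simp only [enorm_eq_self]
    exact iInf_le _ n
  have hzero : eLpNorm H 2 ν = 0 := by
    have := hlim'.add hlim
    rw [add_zero] at this
    exact le_antisymm (ge_of_tendsto' this hle) zero_le
  have hH0 : H =ᵐ[ν] 0 := (eLpNorm_eq_zero_iff hHm.aestronglyMeasurable two_ne_zero).1 hzero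
  have hslice : ∀ᵐ y ∂ν, AEStronglyMeasurable (fun x => G' (x, y)) μ :=
    hG'.prodMk_right
  filter_upwards [hH0, ae_all_iff.2 fun n => (h n).2, hslice] with y hy hG hm
  have hbound : ∀ n, eLpNorm ((fun x => G' (x, y)) - ⇑(f' y)) 2 μ ≤ (A n + B n) y := by
    intro n
    have e1 : eLpNorm ((fun x => G' (x, y)) - ⇑(f n y)) 2 μ = A n y := by
      rw [hA, eLpNorm_sub_comm]
      refine eLpNorm_congr_ae ?_
      filter_upwards [hG n] with x hx
      simp [hx]
    have e2 : eLpNorm (⇑(f n y) - ⇑(f' y)) 2 μ = B n y := by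
      change _ = ‖f n y - f' y‖ₑ
      rw [Lp.enorm_def]
      exact eLpNorm_congr_ae (Lp.coeFn_sub _ _).symm
    have e3 : (fun x => G' (x, y)) - ⇑(f' y) =
        ((fun x => G' (x, y)) - ⇑(f n y)) + (⇑(f n y) - ⇑(f' y)) := by simp
    rw [e3, Pi.add_apply, ← e1, ← e2]
    exact eLpNorm_add_le (hm.sub (Lp.aestronglyMeasurable _))
      ((Lp.aestronglyMeasurable _).sub (Lp.aestronglyMeasurable _)) one_le_two
  have h0 : eLpNorm ((fun x => G' (x, y)) - ⇑(f' y)) 2 μ = 0 :=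
    le_antisymm ((le_iInf hbound).trans_eq hy) zero_le
  rw [eLpNorm_eq_zero_iff (hm.sub (Lp.aestronglyMeasurable _)) two_ne_zero] at h0
  filter_upwards [h0] with x hx
  exact sub_eq_zero.1 hx

/-- By Tonelli, passing to a version preserves the `L²` distance, so versions of a convergent
sequence are Cauchy in the complete space `L²` of the product. -/
theorem isClosed_setOf_exists_isVersion :
    IsClosed {f : Lp (Lp ℂ 2 μ) 2 ν | ∃ G, IsVersion μ ν f G} := by
  refine IsSeqClosed.isClosed fun f f' hf hlim => ?_
  choose G hG using hf
  have hmem : ∀ n, MemLp (G n) 2 (μ.prod ν) := fun n =>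
    ⟨(hG n).1, by rw [(hG n).eLpNorm_eq]; exact Lp.eLpNorm_lt_top _⟩
  set g : ℕ → Lp ℂ 2 (μ.prod ν) := fun n => (hmem n).toLp with hg
  have hdist : ∀ n k, edist (g n) (g k) = edist (f n) (f k) := by
    intro n k
    rw [hg, Lp.edist_toLp_toLp, ((hG n).sub (hG k)).eLpNorm_eq, Lp.edist_def]
  have hcau : CauchySeq g := by
    have := hlim.cauchySeq
    rw [EMetric.cauchySeq_iff] at this ⊢
    simpa [hdist] using this
  obtain ⟨g', hg'⟩ := cauchySeq_tendsto_of_complete hcau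
  refine ⟨g', isVersion_of_tendsto hG (fun n => Lp.aestronglyMeasurable _)
    (Lp.aestronglyMeasurable _) (Lp.aestronglyMeasurable _) ?_ ?_⟩
  · rw [tendsto_iff_edist_tendsto_0] at hlim
    exact hlim.congr fun n => Lp.edist_def _ _
  · rw [tendsto_iff_edist_tendsto_0] at hg'
    refine hg'.congr fun n => ?_
    rw [Lp.edist_def]
    refine eLpNorm_congr_ae ?_
    filter_upwards [(hmem n).coeFn_toLp] with z hz
    simp [hg, hz]

/-- A square integrable family of square integrable functions has a jointly measurable version. -/
theorem exists_isVersion {f : Y → Lp ℂ 2 μ} (hf : MemLp f 2 ν) : ∃ G, IsVersion μ ν f G := by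
  refine MemLp.induction ENNReal.ofNat_ne_top (fun f : Y → Lp ℂ 2 μ => ∃ G, IsVersion μ ν f G)
    ?_ ?_ isClosed_setOf_exists_isVersion ?_ hf
  · intro c s hs _
    refine ⟨fun z => s.indicator (fun _ => (1 : ℂ)) z.2 * c z.1, ?_, ?_⟩
    · refine AEStronglyMeasurable.mul ?_ (Lp.aestronglyMeasurable c).comp_fst
      exact ((stronglyMeasurable_const.indicator hs).comp_measurable
        measurable_snd).aestronglyMeasurable
    · refine Filter.Eventually.of_forall fun y => ?_
      by_cases hy : y ∈ s
      · simp only [indicator_of_mem hy, one_mul]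
        rfl
      · simp only [indicator_of_notMem hy, zero_mul]
        exact (Lp.coeFn_zero ℂ 2 μ).symm
  · rintro f g - - - ⟨G, hG⟩ ⟨H, hH⟩
    refine ⟨G + H, hG.1.add hH.1, ?_⟩
    filter_upwards [hG.2, hH.2] with y h1 h2
    filter_upwards [h1, h2, Lp.coeFn_add (f y) (g y)] with x e1 e2 e3
    simp only [Pi.add_apply] at e3 ⊢
    rw [e3, ← e1, ← e2]
  · rintro f g hfg - ⟨G, hG⟩
    exact ⟨G, hG.congr hfg⟩

end Joint

/-! ### Partial Fourier transforms of square integrable families -/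

section PartialHat

variable {γ s : ℝ} {F : ℝ → PlaneDistribution}

theorem exists_isPartialHat (hF : MemL2Hs γ s F) (hγ : 0 < γ) : ∃ G, IsPartialHat γ F G := by
  obtain ⟨-, Φ, hΦ, hhat⟩ := hF
  obtain ⟨G, hG, hGΦ⟩ := exists_isVersion hΦ
  refine ⟨fun z => ((Lam γ z.1 ^ (-s) : ℝ) : ℂ) * G z, ?_, ?_⟩
  · have hLam : Continuous fun z : Plane × ℝ => ((Lam γ z.1 ^ (-s) : ℝ) : ℂ) :=
      Complex.continuous_ofReal.comp (((continuous_Lam γ).comp continuous_fst).rpow_const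
        fun z => Or.inl (Lam_pos hγ z.1).ne')
    exact hLam.aestronglyMeasurable.mul hG
  · filter_upwards [hhat, hGΦ] with y h1 h2
    refine h1.congr ?_
    filter_upwards [h2] with ξ hξ
    rw [hξ]

theorem ofReal_mul_norm_sq {a : ℝ} (ha : 0 ≤ a) (z : ℂ) :
    ENNReal.ofReal (a * ‖z‖ ^ 2) = ENNReal.ofReal a * ‖z‖ₑ ^ 2 := by
  rw [ENNReal.ofReal_mul ha, ENNReal.ofReal_pow (norm_nonneg _), ofReal_norm]

theorem IsPartialHat.l2NormSq_eq {G : Plane × ℝ → ℂ} (h : IsPartialHat γ F G) (s : ℝ) :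
    l2NormSq γ s F = ENNReal.ofReal (1 / (2 * Real.pi) ^ 2) *
      ∫⁻ ξ : Plane, ENNReal.ofReal (Lam γ ξ ^ (2 * s)) *
        ∫⁻ y in Ioi (0 : ℝ), ‖G (ξ, y)‖ₑ ^ 2 := by
  have hmeas : AEMeasurable (fun z : Plane × ℝ => ENNReal.ofReal (Lam γ z.1 ^ (2 * s)) *
      ‖G z‖ₑ ^ 2) ((volume : Measure Plane).prod (volume.restrict (Ioi (0 : ℝ)))) := by
    refine AEMeasurable.mul (Measurable.aemeasurable ?_) (h.1.enorm.pow_const 2)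
    exact (((continuous_Lam γ).measurable.comp measurable_fst).pow_const _).ennreal_ofReal
  calc l2NormSq γ s F = ∫⁻ y in Ioi (0 : ℝ), ENNReal.ofReal (1 / (2 * Real.pi) ^ 2) *
        ∫⁻ ξ : Plane, ENNReal.ofReal (Lam γ ξ ^ (2 * s)) * ‖G (ξ, y)‖ₑ ^ 2 := by
        refine lintegral_congr_ae ?_
        filter_upwards [h.2] with y hy
        rw [hy.normSq_eq]
        congr 1
        exact lintegral_congr fun ξ =>
          ofReal_mul_norm_sq (Real.rpow_nonneg (Real.sqrt_nonneg _) _) _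
    _ = ENNReal.ofReal (1 / (2 * Real.pi) ^ 2) * ∫⁻ ξ : Plane, ∫⁻ y in Ioi (0 : ℝ),
        ENNReal.ofReal (Lam γ ξ ^ (2 * s)) * ‖G (ξ, y)‖ₑ ^ 2 := by
        rw [lintegral_const_mul' _ _ ENNReal.ofReal_ne_top]
        congr 1
        exact (lintegral_lintegral_swap hmeas).symm
    _ = _ := by
        congr 1
        refine lintegral_congr fun ξ => ?_
        rw [lintegral_const_mul' _ _ ENNReal.ofReal_ne_top]

theorem MemL2Hs.l2NormSq_ne_top (hF : MemL2Hs γ s F) (hγ : 0 < γ) : l2NormSq γ s F ≠ ∞ := by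
  obtain ⟨-, Φ, hΦ, hhat⟩ := hF
  have e : l2NormSq γ s F = ∫⁻ y in Ioi (0 : ℝ), ENNReal.ofReal (1 / (2 * Real.pi) ^ 2) *
      ‖Φ y‖ₑ ^ 2 := by
    refine lintegral_congr_ae ?_
    filter_upwards [hhat] with y hy
    rw [hy.normSq_eq, Lp.enorm_def, eLpNorm_two_sq]
    congr 1
    refine lintegral_congr fun ξ => ?_
    have hL := Lam_pos hγ ξ
    rw [← one_mul (‖Φ y ξ‖ₑ ^ 2), ← ENNReal.ofReal_one, ← ofReal_mul_norm_sq zero_le_one]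
    congr 1
    rw [norm_mul, Complex.norm_real, Real.norm_of_nonneg (by positivity), mul_pow, ← mul_assoc,
      ← Real.rpow_two (Lam γ ξ ^ (-s)), ← Real.rpow_mul hL.le, ← Real.rpow_add hL]
    ring_nf
    simp
  rw [e, lintegral_const_mul' _ _ ENNReal.ofReal_ne_top, ← eLpNorm_two_sq]
  exact ENNReal.mul_ne_top ENNReal.ofReal_ne_top (ENNReal.pow_ne_top hΦ.2.ne)

theorem IsPartialHat.ae_lt_top {G : Plane × ℝ → ℂ} (h : IsPartialHat γ F G) (hγ : 0 < γ)
    (hfin : l2NormSq γ s F ≠ ∞) :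
    ∀ᵐ ξ : Plane, ∫⁻ y in Ioi (0 : ℝ), ‖G (ξ, y)‖ₑ ^ 2 < ∞ := by
  rw [h.l2NormSq_eq s] at hfin
  have hc : ENNReal.ofReal (1 / (2 * Real.pi) ^ 2) ≠ 0 :=
    (ENNReal.ofReal_pos.2 (by positivity)).ne'
  have hfin' := fun h0 => hfin (ENNReal.mul_eq_top.2 (Or.inl ⟨hc, h0⟩))
  have hN : AEMeasurable (fun ξ : Plane => ∫⁻ y in Ioi (0 : ℝ), ‖G (ξ, y)‖ₑ ^ 2) := by
    have : AEMeasurable (fun z : Plane × ℝ => ‖G z‖ₑ ^ 2)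
      ((volume : Measure Plane).prod (volume.restrict (Ioi (0 : ℝ)))) := h.1.enorm.pow_const 2
    exact this.lintegral_prod_right'
  have hw : Measurable (fun ξ : Plane => ENNReal.ofReal (Lam γ ξ ^ (2 * s))) :=
    ((continuous_Lam γ).measurable.pow_const _).ennreal_ofReal
  filter_upwards [ae_lt_top' (hw.aemeasurable.mul hN) hfin'] with ξ hξ
  by_contra h0
  rw [not_lt, top_le_iff] at h0
  rw [Pi.mul_apply, h0, ENNReal.mul_top] at hξ
  · exact lt_irrefl _ hξ
  · exact (ENNReal.ofReal_pos.2 (Real.rpow_pos_of_pos (Lam_pos hγ ξ) _)).ne'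

/-- Uniqueness of `û` gives equality in `ξ` for almost every `y`; Tonelli exchanges the order, as
`M` is computed at fixed `ξ`. -/
theorem IsPartialHat.ae_ae_eq {G G' : Plane × ℝ → ℂ} (h : IsPartialHat γ F G)
    (h' : IsPartialHat γ F G') :
    ∀ᵐ ξ : Plane, ∀ᵐ y ∂(volume.restrict (Ioi (0 : ℝ))), G (ξ, y) = G' (ξ, y) := by
  have hm : AEMeasurable (fun z : Plane × ℝ => ‖G z - G' z‖ₑ)
      ((volume : Measure Plane).prod (volume.restrict (Ioi (0 : ℝ)))) := (h.1.sub h'.1).enorm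
  have h0 : ∫⁻ z, ‖G z - G' z‖ₑ
      ∂((volume : Measure Plane).prod (volume.restrict (Ioi (0 : ℝ)))) = 0 := by
    rw [lintegral_prod_symm _ hm]
    refine lintegral_eq_zero_of_ae_eq_zero ?_
    filter_upwards [h.2, h'.2] with y h1 h2
    refine lintegral_eq_zero_of_ae_eq_zero ?_
    filter_upwards [h1.ae_eq h2] with ξ hξ
    simp [hξ]
  rw [lintegral_eq_zero_iff' hm] at h0
  filter_upwards [Measure.ae_ae_of_ae_prod h0] with ξ hξ
  filter_upwards [hξ] with y hy
  simpa [sub_eq_zero] using hy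

end PartialHat

/-! ### The Laplace type integrals in the source term -/

section Laplace

variable {p : ℂ} {g : ℝ → ℂ}

theorem norm_exp_neg_mul (p : ℂ) (y : ℝ) :
    ‖Complex.exp (-p * (y : ℂ))‖ ^ 2 = Real.exp (-(2 * p.re) * y) := by
  rw [Complex.norm_exp, ← Real.exp_nat_mul]
  congr 1
  simp
  ring

theorem memLp_exp_neg_mul (hp : 0 < p.re) :
    MemLp (fun y : ℝ => Complex.exp (-p * (y : ℂ))) 2 (volume.restrict (Ioi 0)) := by
  rw [memLp_two_iff_integrable_sq_norm (Continuous.aestronglyMeasurable (by fun_prop))]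
  simp_rw [norm_exp_neg_mul]
  exact exp_neg_integrableOn_Ioi 0 (by positivity)

theorem lintegral_exp_neg_mul (hp : 0 < p.re) :
    ∫⁻ y in Ioi (0 : ℝ), ‖Complex.exp (-p * (y : ℂ))‖ₑ ^ 2 = ENNReal.ofReal (1 / (2 * p.re)) := by
  have e : ∀ y : ℝ, ‖Complex.exp (-p * (y : ℂ))‖ₑ ^ 2 =
      ENNReal.ofReal (Real.exp (-(2 * p.re) * y)) := fun y => by
    rw [← norm_exp_neg_mul, ENNReal.ofReal_pow (norm_nonneg _), ofReal_norm]
  simp_rw [e]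
  rw [← ofReal_integral_eq_lintegral_ofReal (exp_neg_integrableOn_Ioi 0 (by positivity))
    (Filter.Eventually.of_forall fun y => (Real.exp_pos _).le),
    integral_exp_mul_Ioi (by linarith)]
  congr 1
  simp [neg_div_neg_eq]

theorem integrableOn_exp_mul (hp : 0 < p.re)
    (hg : AEStronglyMeasurable g (volume.restrict (Ioi 0)))
    (hfin : ∫⁻ y in Ioi (0 : ℝ), ‖g y‖ₑ ^ 2 < ∞) :
    IntegrableOn (fun y : ℝ => Complex.exp (-p * (y : ℂ)) * g y) (Ioi 0) := by
  refine (memLp_exp_neg_mul hp).integrable_mul (q := 2) ⟨hg, ?_⟩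
  rw [eLpNorm_two_eq]
  exact ENNReal.rpow_lt_top_of_nonneg (by norm_num) hfin.ne

/-- Cauchy–Schwarz against the exponential, whose squared `L²` norm is `1 / (2 Re p)`; this is where
half a power of `γ` is gained. -/
theorem enorm_integral_exp_mul_sq_le (hp : 0 < p.re)
    (hg : AEStronglyMeasurable g (volume.restrict (Ioi 0))) :
    ‖∫ y in Ioi (0 : ℝ), Complex.exp (-p * (y : ℂ)) * g y‖ₑ ^ 2 ≤
      ENNReal.ofReal (1 / (2 * p.re)) * ∫⁻ y in Ioi (0 : ℝ), ‖g y‖ₑ ^ 2 := by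
  have h1 : ‖∫ y in Ioi (0 : ℝ), Complex.exp (-p * (y : ℂ)) * g y‖ₑ ≤
      ∫⁻ y in Ioi (0 : ℝ), ‖Complex.exp (-p * (y : ℂ))‖ₑ * ‖g y‖ₑ := by
    refine (enorm_integral_le_lintegral_enorm _).trans_eq ?_
    simp_rw [enorm_mul]
  have h2 := ENNReal.lintegral_mul_le_Lp_mul_Lq (volume.restrict (Ioi (0 : ℝ)))
    Real.HolderConjugate.two_two
    (memLp_exp_neg_mul hp).1.enorm hg.enorm
  have h3 := h1.trans h2
  simp only [ENNReal.rpow_two] at h3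
  rw [lintegral_exp_neg_mul hp] at h3
  calc _ ≤ _ := pow_le_pow_left₀ zero_le h3 2
    _ = _ := by
      rw [mul_pow, ← ENNReal.rpow_natCast, ← ENNReal.rpow_natCast, ← ENNReal.rpow_mul,
        ← ENNReal.rpow_mul]
      norm_num

end Laplace

/-! ### The front equation -/

theorem tau_re_pos {γ : ℝ} (hγ : 0 < γ) (δ : ℝ) : 0 < (tau γ δ).re := by simpa [tau] using hγ

theorem le_muPlus_re (v : ℝ) {c : ℝ} (hc : 0 < c) {γ : ℝ} (hγ : 0 < γ) (δ η : ℝ) :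
    γ / c ≤ (muPlus v c (tau γ δ) η).re := by
  have := (rootPair_mu v hc (tau_re_pos hγ δ) η).re_le_p
  rw [Complex.div_ofReal_re] at this
  simpa [tau] using this

theorem le_muMinus_re (v : ℝ) {c : ℝ} (hc : 0 < c) {γ : ℝ} (hγ : 0 < γ) (δ η : ℝ) :
    γ / c ≤ (muMinus v c (tau γ δ) η).re := by
  have := (rootPair_mu v hc (tau_re_pos hγ δ) η).re_le_q
  rw [Complex.div_ofReal_re] at this
  simpa [tau] using this

theorem measurable_root (v c ε γ : ℝ) :
    Measurable fun ξ : Plane => root v c ε (tau γ (ξ 0)) (ξ 1) := by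
  have : Continuous fun ξ : Plane => radicand v c ε (tau γ (ξ 0)) (ξ 1) := by
    unfold radicand tau
    fun_prop
  exact this.measurable.pow_const _

theorem measurable_symbol (v c γ : ℝ) :
    Measurable fun ξ : Plane => symbol v c (tau γ (ξ 0)) (ξ 1) := by
  have hτ : Continuous fun ξ : Plane => tau γ (ξ 0) := by unfold tau; fun_prop
  have hη : Continuous fun ξ : Plane => ((ξ 1 : ℝ) : ℂ) := by fun_prop
  have hp : Measurable fun ξ : Plane => muPlus v c (tau γ (ξ 0)) (ξ 1) := measurable_root v c 1 γ
  have hq : Measurable fun ξ : Plane => muMinus v c (tau γ (ξ 0)) (ξ 1) :=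
    measurable_root v c (-1) γ
  unfold symbol
  have h1 := hτ.measurable
  have h2 := hη.measurable
  fun_prop

theorem aestronglyMeasurable_integral_exp {μ : Plane → ℂ} (hμ : Measurable μ) {G : Plane × ℝ → ℂ}
    (hG : AEStronglyMeasurable G
      ((volume : Measure Plane).prod (volume.restrict (Ioi (0 : ℝ))))) :
    AEStronglyMeasurable fun ξ : Plane =>
      ∫ y in Ioi (0 : ℝ), Complex.exp (-μ ξ * (y : ℂ)) * G (ξ, y) := by
  have h : AEStronglyMeasurable (fun z : Plane × ℝ => Complex.exp (-μ z.1 * (z.2 : ℂ)) * G z)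
      ((volume : Measure Plane).prod (volume.restrict (Ioi (0 : ℝ)))) := by
    refine AEStronglyMeasurable.mul (Measurable.aestronglyMeasurable ?_) hG
    fun_prop
  exact h.integral_prod_right'

/-- Solutions of the front equation are unique. -/
theorem SolvesFrontEq.eq {v c γ : ℝ} {Fp Fm : ℝ → PlaneDistribution} {f g : PlaneDistribution}
    (hsymb : ∀ ξ : Plane, symbol v c (tau γ (ξ 0)) (ξ 1) ≠ 0)
    (hf : SolvesFrontEq v c γ Fp Fm f) (hg : SolvesFrontEq v c γ Fp Fm g) : f = g := by
  obtain ⟨fhat, Gp, Gm, hfh, hGp, hGm, hfe⟩ := hf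
  obtain ⟨ghat, Gp', Gm', hgh, hGp', hGm', hge⟩ := hg
  have hae : fhat =ᵐ[volume] ghat := by
    filter_upwards [hfe, hge, hGp.ae_ae_eq hGp', hGm.ae_ae_eq hGm'] with ξ h1 h2 h3 h4
    have hM : sourceM v c γ Gp Gm ξ = sourceM v c γ Gp' Gm' ξ := by
      unfold sourceM
      congr 2
      · refine integral_congr_ae ?_
        filter_upwards [h3] with y hy
        rw [hy]
      · refine integral_congr_ae ?_
        filter_upwards [h4] with y hy
        rw [hy]
    have := h1.2.2.trans h2.2.2.symm
    rw [hM] at this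
    exact mul_left_cancel₀ (hsymb ξ) (add_right_cancel this)
  exact (hfh.congr hae).eq hgh

/-- The elementary estimate for the solution of the front equation at a single frequency. -/
theorem norm_solution_le {S p q I J : ℂ} {k : ℝ} (hk : 0 < k) (hp : p ≠ 0) (hq : q ≠ 0)
    (h1 : k * ‖p‖ ≤ ‖S‖ * ‖p + q‖) (h2 : k * ‖q‖ ≤ ‖S‖ * ‖p + q‖) :
    k * ‖-(p * q / (p + q) * (1 / p * I - 1 / q * J)) / S‖ ≤ ‖I‖ + ‖J‖ := by
  have hpos : 0 < ‖S‖ * ‖p + q‖ := lt_of_lt_of_le (by positivity) h1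
  have hS : S ≠ 0 := fun h => by simp [h] at hpos
  have hpq : p + q ≠ 0 := fun h => by simp [h] at hpos
  have e : -(p * q / (p + q) * (1 / p * I - 1 / q * J)) / S =
      -(q * I - p * J) / (S * (p + q)) := by
    field_simp
  rw [e, norm_div, norm_neg, norm_mul S, ← mul_div_assoc, div_le_iff₀ hpos]
  calc k * ‖q * I - p * J‖ ≤ k * (‖q‖ * ‖I‖ + ‖p‖ * ‖J‖) := by
        gcongr
        refine (norm_sub_le _ _).trans_eq ?_
        rw [norm_mul, norm_mul]
    _ = (k * ‖q‖) * ‖I‖ + (k * ‖p‖) * ‖J‖ := by ring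
    _ ≤ (‖S‖ * ‖p + q‖) * ‖I‖ + (‖S‖ * ‖p + q‖) * ‖J‖ := by gcongr
    _ = _ := by ring

/-- Squaring the pointwise bound yields `γ²Λ²`, and the factor `c / (2γ)` of the Laplace integrals
supplies the third power of `γ`. -/
theorem lintegral_solution_le {c γ k s : ℝ} (hc : 0 < c) (hγ : 0 < γ) (hk : 0 < k)
    {w I J : Plane → ℂ} {N N' : Plane → ℝ≥0∞} (hN : AEMeasurable N)
    (hw : ∀ ξ, k * (γ * Lam γ ξ) * ‖w ξ‖ ≤ ‖I ξ‖ + ‖J ξ‖)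
    (hI : ∀ᵐ ξ, ‖I ξ‖ₑ ^ 2 ≤ ENNReal.ofReal (c / (2 * γ)) * N ξ)
    (hJ : ∀ᵐ ξ, ‖J ξ‖ₑ ^ 2 ≤ ENNReal.ofReal (c / (2 * γ)) * N' ξ) :
    ENNReal.ofReal (γ ^ 3) *
      ∫⁻ ξ : Plane, ENNReal.ofReal (Lam γ ξ ^ (2 * (s + 1)) * ‖w ξ‖ ^ 2) ≤
    ENNReal.ofReal (c / k ^ 2) *
      ((∫⁻ ξ : Plane, ENNReal.ofReal (Lam γ ξ ^ (2 * s)) * N ξ) +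
        ∫⁻ ξ : Plane, ENNReal.ofReal (Lam γ ξ ^ (2 * s)) * N' ξ) := by
  have hL : Measurable (fun ξ : Plane => ENNReal.ofReal (Lam γ ξ ^ (2 * s))) :=
    ((continuous_Lam γ).measurable.pow_const _).ennreal_ofReal
  have hLN : AEMeasurable fun ξ : Plane => ENNReal.ofReal (Lam γ ξ ^ (2 * s)) * N ξ :=
    hL.aemeasurable.mul hN
  rw [← lintegral_const_mul' _ _ ENNReal.ofReal_ne_top,
    ← lintegral_add_left' hLN,
    ← lintegral_const_mul' _ _ ENNReal.ofReal_ne_top]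
  refine lintegral_mono_ae ?_
  filter_upwards [hI, hJ] with ξ hI hJ
  have hΛ := Lam_pos hγ ξ
  set Λ := Lam γ ξ
  have hr : γ ^ 3 * (Λ ^ (2 * (s + 1)) * ‖w ξ‖ ^ 2) ≤
      (2 * γ / k ^ 2 * Λ ^ (2 * s)) * (‖I ξ‖ ^ 2 + ‖J ξ‖ ^ 2) := by
    have e1 : Λ ^ (2 * (s + 1)) = Λ ^ (2 * s) * Λ ^ 2 := by
      rw [← Real.rpow_two, ← Real.rpow_add hΛ]
      ring_nf
    have e2 : (k * (γ * Λ) * ‖w ξ‖) ^ 2 ≤ (‖I ξ‖ + ‖J ξ‖) ^ 2 := by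
      have := hw ξ
      gcongr
    have e3 : (‖I ξ‖ + ‖J ξ‖) ^ 2 ≤ 2 * (‖I ξ‖ ^ 2 + ‖J ξ‖ ^ 2) := add_sq_le
    calc γ ^ 3 * (Λ ^ (2 * (s + 1)) * ‖w ξ‖ ^ 2)
        = (γ / k ^ 2 * Λ ^ (2 * s)) * (k * (γ * Λ) * ‖w ξ‖) ^ 2 := by
          rw [e1]; field_simp
      _ ≤ (γ / k ^ 2 * Λ ^ (2 * s)) * (2 * (‖I ξ‖ ^ 2 + ‖J ξ‖ ^ 2)) := by
          gcongr
          exact e2.trans e3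
      _ = _ := by ring
  have hpos : 0 ≤ 2 * γ / k ^ 2 * Λ ^ (2 * s) := by positivity
  calc ENNReal.ofReal (γ ^ 3) * ENNReal.ofReal (Λ ^ (2 * (s + 1)) * ‖w ξ‖ ^ 2)
      = ENNReal.ofReal (γ ^ 3 * (Λ ^ (2 * (s + 1)) * ‖w ξ‖ ^ 2)) :=
        (ENNReal.ofReal_mul (by positivity)).symm
    _ ≤ ENNReal.ofReal ((2 * γ / k ^ 2 * Λ ^ (2 * s)) * (‖I ξ‖ ^ 2 + ‖J ξ‖ ^ 2)) :=
        ENNReal.ofReal_le_ofReal hr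
    _ = ENNReal.ofReal (2 * γ / k ^ 2 * Λ ^ (2 * s)) * (‖I ξ‖ₑ ^ 2 + ‖J ξ‖ₑ ^ 2) := by
        rw [mul_add, ENNReal.ofReal_add (by positivity) (by positivity), ofReal_mul_norm_sq hpos,
          ofReal_mul_norm_sq hpos, mul_add]
    _ ≤ ENNReal.ofReal (2 * γ / k ^ 2 * Λ ^ (2 * s)) *
        (ENNReal.ofReal (c / (2 * γ)) * N ξ + ENNReal.ofReal (c / (2 * γ)) * N' ξ) := by
        gcongr
    _ = (ENNReal.ofReal (2 * γ / k ^ 2 * Λ ^ (2 * s)) * ENNReal.ofReal (c / (2 * γ))) *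
        (N ξ + N' ξ) := by ring
    _ = (ENNReal.ofReal (c / k ^ 2) * ENNReal.ofReal (Λ ^ (2 * s))) * (N ξ + N' ξ) := by
        rw [← ENNReal.ofReal_mul hpos, ← ENNReal.ofReal_mul (by positivity)]
        congr 2
        field_simp
    _ = _ := by ring

end VortexSheet
end

/-! ### Existence, uniqueness and the estimate -/

theorem mainTheorem6 (v c s : ℝ) (hv : 0 < v) (hc : 0 < c) (hM : Real.sqrt 2 < v / c) :
    ∃ C : ℝ, 0 < C ∧
      ∀ γ : ℝ, 1 ≤ γ → ∀ Fp Fm : ℝ → VortexSheet.PlaneDistribution,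
        VortexSheet.MemL2Hs γ s Fp →
        VortexSheet.MemL2Hs γ s (VortexSheet.reflect Fm) →
        ∃ f : VortexSheet.PlaneDistribution,
          (VortexSheet.MemHs γ (s + 1) f ∧ VortexSheet.SolvesFrontEq v c γ Fp Fm f) ∧
          (∀ g : VortexSheet.PlaneDistribution,
            VortexSheet.MemHs γ (s + 1) g → VortexSheet.SolvesFrontEq v c γ Fp Fm g → g = f) ∧
          ENNReal.ofReal (γ ^ 3) * VortexSheet.normSq γ (s + 1) f ≤
            ENNReal.ofReal C *
              (VortexSheet.l2NormSq γ s Fp +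
                VortexSheet.l2NormSq γ s (VortexSheet.reflect Fm)) := by
  open VortexSheet in
  obtain ⟨k, hk, hbound⟩ := exists_symbol_bound hc hM
  refine ⟨c / k ^ 2, by positivity, fun γ hγ Fp Fm hFp hFm => ?_⟩
  have hγ0 : 0 < γ := by linarith
  set p : Plane → ℂ := fun ξ => muPlus v c (tau γ (ξ 0)) (ξ 1) with hp
  set q : Plane → ℂ := fun ξ => muMinus v c (tau γ (ξ 0)) (ξ 1) with hq
  have hpm : Measurable p := measurable_root v c 1 γ
  have hqm : Measurable q := measurable_root v c (-1) γ
  have hpre : ∀ ξ, γ / c ≤ (p ξ).re := fun ξ => le_muPlus_re v hc hγ0 _ _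
  have hqre : ∀ ξ, γ / c ≤ (q ξ).re := fun ξ => le_muMinus_re v hc hγ0 _ _
  have hγc : 0 < γ / c := by positivity
  have hp0 : ∀ ξ, p ξ ≠ 0 := fun ξ h => by simpa [h] using hγc.trans_le (hpre ξ)
  have hq0 : ∀ ξ, q ξ ≠ 0 := fun ξ h => by simpa [h] using hγc.trans_le (hqre ξ)
  have hsymb : ∀ ξ : Plane, symbol v c (tau γ (ξ 0)) (ξ 1) ≠ 0 := fun ξ h => by
    have h1 := (hbound γ hγ0 ξ).1
    have h2 : 0 < k * (γ * Lam γ ξ) * ‖p ξ‖ := by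
      have := Lam_pos hγ0 ξ
      have := hp0 ξ
      positivity
    rw [h, norm_zero, zero_mul] at h1
    exact absurd h1 (not_le.2 h2)
  obtain ⟨Gp, hGp⟩ := exists_isPartialHat hFp hγ0
  obtain ⟨Gm, hGm⟩ := exists_isPartialHat hFm hγ0
  set I : Plane → ℂ := fun ξ => ∫ y in Ioi (0 : ℝ), Complex.exp (-p ξ * (y : ℂ)) * Gp (ξ, y)
    with hI
  set J : Plane → ℂ := fun ξ => ∫ y in Ioi (0 : ℝ), Complex.exp (-q ξ * (y : ℂ)) * Gm (ξ, y)
    with hJ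
  -- The equation solved for `f̂` pointwise; the symbol vanishes nowhere.
  set w : Plane → ℂ := fun ξ => -(p ξ * q ξ / (p ξ + q ξ) *
    (1 / p ξ * I ξ - 1 / q ξ * J ξ)) / symbol v c (tau γ (ξ 0)) (ξ 1) with hw
  have hIm : AEStronglyMeasurable I := aestronglyMeasurable_integral_exp hpm hGp.1
  have hJm : AEStronglyMeasurable J := aestronglyMeasurable_integral_exp hqm hGm.1
  have hwm : AEStronglyMeasurable w := by
    have h1 := (hpm.mul hqm).div (hpm.add hqm)
    have h2 := (measurable_const (a := (1 : ℂ))).div hpm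
    have h3 := (measurable_const (a := (1 : ℂ))).div hqm
    exact (((h1.aemeasurable.mul ((h2.aemeasurable.mul hIm.aemeasurable).sub
      (h3.aemeasurable.mul hJm.aemeasurable))).neg).div
        (measurable_symbol v c γ).aemeasurable).aestronglyMeasurable
  have hcs : ∀ {a : ℂ}, γ / c ≤ a.re → ENNReal.ofReal (1 / (2 * a.re)) ≤
      ENNReal.ofReal (c / (2 * γ)) := fun {a} ha => by
    refine ENNReal.ofReal_le_ofReal ?_
    rw [div_le_div_iff₀ (by linarith) (by positivity)]
    rw [div_le_iff₀ hc] at ha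
    linarith
  have hsliceP := hGp.1.prodMk_left
  have hsliceM := hGm.1.prodMk_left
  have hIle : ∀ᵐ ξ, ‖I ξ‖ₑ ^ 2 ≤ ENNReal.ofReal (c / (2 * γ)) *
      ∫⁻ y in Ioi (0 : ℝ), ‖Gp (ξ, y)‖ₑ ^ 2 := by
    filter_upwards [hsliceP] with ξ hξ
    refine (enorm_integral_exp_mul_sq_le (hγc.trans_le (hpre ξ)) hξ).trans ?_
    exact mul_le_mul' (hcs (hpre ξ)) le_rfl
  have hJle : ∀ᵐ ξ, ‖J ξ‖ₑ ^ 2 ≤ ENNReal.ofReal (c / (2 * γ)) *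
      ∫⁻ y in Ioi (0 : ℝ), ‖Gm (ξ, y)‖ₑ ^ 2 := by
    filter_upwards [hsliceM] with ξ hξ
    refine (enorm_integral_exp_mul_sq_le (hγc.trans_le (hqre ξ)) hξ).trans ?_
    exact mul_le_mul' (hcs (hqre ξ)) le_rfl
  have hN : AEMeasurable (fun ξ : Plane => ∫⁻ y in Ioi (0 : ℝ), ‖Gp (ξ, y)‖ₑ ^ 2) := by
    have : AEMeasurable (fun z : Plane × ℝ => ‖Gp z‖ₑ ^ 2)
      ((volume : Measure Plane).prod (volume.restrict (Ioi (0 : ℝ)))) := hGp.1.enorm.pow_const 2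
    exact this.lintegral_prod_right'
  have hmain := lintegral_solution_le (s := s) hc hγ0 hk hN (w := w)
    (fun ξ => norm_solution_le (mul_pos hk (mul_pos hγ0 (Lam_pos hγ0 ξ))) (hp0 ξ) (hq0 ξ)
      (hbound γ hγ0 ξ).1 (hbound γ hγ0 ξ).2) hIle hJle
  have hest : ENNReal.ofReal (γ ^ 3) * (ENNReal.ofReal (1 / (2 * Real.pi) ^ 2) *
      ∫⁻ ξ : Plane, ENNReal.ofReal (Lam γ ξ ^ (2 * (s + 1)) * ‖w ξ‖ ^ 2)) ≤
      ENNReal.ofReal (c / k ^ 2) * (l2NormSq γ s Fp + l2NormSq γ s (reflect Fm)) := by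
    rw [hGp.l2NormSq_eq s, hGm.l2NormSq_eq s, ← mul_add, mul_left_comm,
      mul_left_comm (ENNReal.ofReal (c / k ^ 2))]
    gcongr
  have hFpt := hFp.l2NormSq_ne_top hγ0
  have hFmt := hFm.l2NormSq_ne_top hγ0
  -- The estimate is proved for `w` before `f` exists; finiteness then allows `w` to be realised as
  -- the transform of a distribution.
  have hfin : ∫⁻ ξ : Plane, ENNReal.ofReal (Lam γ ξ ^ (2 * (s + 1)) * ‖w ξ‖ ^ 2) ≠ ⊤ := by
    intro h
    rw [h, ENNReal.mul_top (ENNReal.ofReal_pos.2 (by positivity)).ne',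
      ENNReal.mul_top (ENNReal.ofReal_pos.2 (by positivity)).ne', top_le_iff] at hest
    exact ENNReal.mul_ne_top ENNReal.ofReal_ne_top (ENNReal.add_ne_top.2 ⟨hFpt, hFmt⟩) hest
  obtain ⟨f, hf, hfw⟩ := exists_memHs_isHat hγ (s + 1) hwm hfin
  have hsolves : SolvesFrontEq v c γ Fp Fm f := by
    refine ⟨w, Gp, Gm, hfw, hGp, hGm, ?_⟩
    filter_upwards [hsliceP, hsliceM, hGp.ae_lt_top hγ0 hFpt, hGm.ae_lt_top hγ0 hFmt]
      with ξ h1 h2 h3 h4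
    refine ⟨integrableOn_exp_mul (hγc.trans_le (hpre ξ)) h1 h3,
      integrableOn_exp_mul (hγc.trans_le (hqre ξ)) h2 h4, ?_⟩
    change symbol v c (tau γ (ξ 0)) (ξ 1) * w ξ + p ξ * q ξ / (p ξ + q ξ) *
      (1 / p ξ * I ξ - 1 / q ξ * J ξ) = 0
    rw [hw]
    simp only
    rw [mul_div_cancel₀ _ (hsymb ξ), neg_add_cancel]
  refine ⟨f, ⟨hf, hsolves⟩, fun g _ hg => hg.eq hsymb hsolves, ?_⟩
  rw [hfw.normSq_eq]
  exact hest
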